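/- Let $Q=(\mathbb R/\mathbb Z)^2$, with distance $|x-y|_{\rm per}=\min_{z\in\mathbb Z^2}|x-y-z|$, and for probability measures $\alpha,\beta$ on $Q$ let $$W_{\rm per}^2(\alpha,\beta)=\min_\pi\int_{Q\times Q}|x-y|_{\rm per}^2\,d\pi(x,y),$$ the minimum being over all measures $\pi$ on $Q\times Q$ with marginals $\alpha$ and $\beta$. For $T>0$ let $Q_T=(-T,T)\times Q$. An admissible pair $(\mu,m)$ consists of a finite positive measure $\mu$ on $Q_T$ of the form $\mu=dt\otimes\mu_t$, where for a.e. $t\in(-T,T)$ the measure $\mu_t$ is a countable sum of weighted Dirac masses, and of a finite $\mathbb R^2$-valued measure $m\ll\mu$ on $Q_T$ such that $\partial_t\mu+\nabla\cdot m=0$ in $Q_T$ in the sense of distributions. Set $$I(\mu,m)=\int_{-T}^{T}\sum_{x\in Q}\big(\mu_t(\{x\})\big)^{1/2}\,dt+\int_{Q_T}\Big|\frac{dm}{d\mu}\Big|^2d\mu\in[0,\infty],\qquad I(\mu)=\min_m I(\mu,m),$$ where the minimum is over all $m$ for which $(\mu,m)$ is admissible. For probability measures $\bar\mu_\pm$ on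 $Q$, write $\mu_{\pm T}=\bar\mu_\pm$ if $t\mapsto\mu_t$ agrees for a.e. $t$ with a curve of measures that is weakly continuous on $[-T,T]$ and equals $\bar\mu_-$ at $t=-T$ and $\bar\mu_+$ at $t=T$. **Proposition 3.5.** There is a universal constant $C>0$ such that for every $T>0$ and all probability measures $\bar\mu_\pm$ on $Q$, the minimum of $I(\mu)$ over all $\mu$ that belong to an admissible pair and satisfy $\mu_{\pm T}=\bar\mu_\pm$ is attained, and for every $\eta\in(0,1)$ $$\min\{I(\mu):\mu_{\pm T}=\bar\mu_\pm\}\le\frac{1+\eta}{2T}\,W_{\rm per}^2(\bar\mu_-,\bar\mu_+)+\frac{C}{\eta}\max\big(T,T^{1/3}\big).$$ -/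

import Mathlib

open MeasureTheory ProbabilityTheory Set
open scoped ENNReal ContDiff

noncomputable section

/-- The two-dimensional torus `Q = (ℝ/ℤ)²`. -/
abbrev Torus2 : Type := UnitAddTorus (Fin 2)

/-- The quotient map `ℝ² → Q`. -/
def torusMk (y : EuclideanSpace ℝ (Fin 2)) : Torus2 := fun i => (y i : UnitAddCircle)

/-- The squared Euclidean distance on the torus, `min_{z ∈ ℤ²} |x - y - z|²`. The minimum splits over
the coordinates, and the norm of `UnitAddCircle` is the distance of a real representative to `ℤ`. -/
def perDistSq (x y : Torus2) : ℝ := ∑ i, ‖x i - y i‖ ^ 2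

/-- The squared periodic `2`-Wasserstein distance: the least cost of a transport plan `π` on `Q × Q`
with marginals `α` and `β`. -/
def wassersteinPerSq (α β : Measure Torus2) : ℝ≥0∞ :=
  ⨅ (π : Measure (Torus2 × Torus2)) (_ : π.fst = α ∧ π.snd = β),
    ∫⁻ p, ENNReal.ofReal (perDistSq p.1 p.2) ∂π

/-- The measure `μ = dt ⊗ μ_t` on `Q_T = (-T, T) × Q` with slices `μ_t = κ t`
(as a measure on `ℝ × Q` which does not charge the complement of `Q_T`). -/
def spaceTime (T : ℝ) (κ : Kernel ℝ Torus2) : Measure (ℝ × Torus2) :=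
  (volume.restrict (Ioo (-T) T)).compProd κ

/-- The `i`-th coordinate, as an additive map `ℝ² → ℝ`. -/
def coordHom (i : Fin 2) : EuclideanSpace ℝ (Fin 2) →+ ℝ where
  toFun y := y i
  map_zero' := rfl
  map_add' _ _ := rfl

theorem continuous_coordHom (i : Fin 2) : Continuous (coordHom i) :=
  (EuclideanSpace.proj (𝕜 := ℝ) i : EuclideanSpace ℝ (Fin 2) →L[ℝ] ℝ).continuous

/-- The Radon-Nikodym density `dm/dμ` of an `ℝ²`-valued measure, coordinate by coordinate. -/
def fluxDensity (m : VectorMeasure (ℝ × Torus2) (EuclideanSpace ℝ (Fin 2)))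
    (μ : Measure (ℝ × Torus2)) (z : ℝ × Torus2) : EuclideanSpace ℝ (Fin 2) :=
  WithLp.toLp 2 fun i =>
    SignedMeasure.rnDeriv (m.mapRange (coordHom i) (continuous_coordHom i)) μ z

/-- The time derivative `∂_t f`. -/
def timeDeriv (f : ℝ × Torus2 → ℝ) (z : ℝ × Torus2) : ℝ :=
  deriv (fun s : ℝ => f (s, z.2)) z.1

/-- The horizontal gradient `∇ f`: the `i`-th entry is the derivative in the direction `x_i`. -/
def horGrad (f : ℝ × Torus2 → ℝ) (z : ℝ × Torus2) : EuclideanSpace ℝ (Fin 2) :=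
  WithLp.toLp 2 fun i => deriv (fun h : ℝ => f (z.1, z.2 + Pi.single i (h : UnitAddCircle))) 0

/-- The test functions `f ∈ C_c^∞((-T, T) × Q)`: smooth in the sense that the lift to `ℝ × ℝ²`
is smooth, with compact support inside `(-T, T) × Q`. -/
structure IsTestFunction (T : ℝ) (f : ℝ × Torus2 → ℝ) : Prop where
  smooth : ContDiff ℝ ∞ fun p : ℝ × EuclideanSpace ℝ (Fin 2) => f (p.1, torusMk p.2)
  compact : HasCompactSupport f
  support : tsupport f ⊆ Ioo (-T) T ×ˢ univ

/-- The continuity equation `∂_t μ + ∇ · m = 0` in `(-T, T) × Q`, in the sense of distributions,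
for `m ≪ μ` (so that `∫ ∇f · dm = ∫ ∇f · (dm/dμ) dμ`). -/
def ContinuityEquation (T : ℝ) (μ : Measure (ℝ × Torus2))
    (m : VectorMeasure (ℝ × Torus2) (EuclideanSpace ℝ (Fin 2))) : Prop :=
  ∀ f : ℝ × Torus2 → ℝ, IsTestFunction T f →
    ∫ z, timeDeriv f z ∂μ + ∫ z, inner ℝ (horGrad f z) (fluxDensity m μ z) ∂μ = 0

/-- A measure of the form `∑ φ_i δ_{X_i}` with countably many terms
(finite sums are included, since weights may vanish). -/
def IsDiscreteMeasure (ν : Measure Torus2) : Prop :=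
  ∃ (φ : ℕ → ℝ≥0∞) (X : ℕ → Torus2), ν = Measure.sum fun i => φ i • Measure.dirac (X i)

/-- The admissible pairs `(μ, m)` with `μ = dt ⊗ μ_t`, where `μ_t = κ t` is determined up to a null
set of times. -/
structure IsAdmissible (T : ℝ) (κ : Kernel ℝ Torus2)
    (m : VectorMeasure (ℝ × Torus2) (EuclideanSpace ℝ (Fin 2))) : Prop where
  finite : IsFiniteKernel κ
  discrete : ∀ᵐ t ∂(volume.restrict (Ioo (-T) T)), IsDiscreteMeasure (κ t)
  absCont : VectorMeasure.AbsolutelyContinuous m (spaceTime T κ).toENNRealVectorMeasure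
  continuityEq : ContinuityEquation T (spaceTime T κ) m

/-- The energy of a pair,
`I(μ, m) = ∫_{-T}^T ∑_{x ∈ Q} μ_t({x})^{1/2} dt + ∫_{Q_T} |dm/dμ|² dμ`. -/
def pairEnergy (T : ℝ) (κ : Kernel ℝ Torus2)
    (m : VectorMeasure (ℝ × Torus2) (EuclideanSpace ℝ (Fin 2))) : ℝ≥0∞ :=
  (∫⁻ t in Ioo (-T) T, ∑' x : Torus2, (κ t {x}) ^ (1 / 2 : ℝ)) +
    ∫⁻ z, ‖fluxDensity m (spaceTime T κ) z‖ₑ ^ 2 ∂(spaceTime T κ)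

/-- The energy `I(μ)`: the least value of `I(μ, m)` among the fluxes `m` admissible for `μ`. -/
def irrigationEnergy (T : ℝ) (κ : Kernel ℝ Torus2) : ℝ≥0∞ :=
  ⨅ (m : VectorMeasure (ℝ × Torus2) (EuclideanSpace ℝ (Fin 2))) (_ : IsAdmissible T κ m),
    pairEnergy T κ m

/-- The boundary conditions `μ_{-T} = α` and `μ_T = β`: the curve `t ↦ μ_t` has a representative
(equal for almost every time) that is weakly continuous on `[-T, T]`, with these end points. -/
def HasTraces (T : ℝ) (κ : Kernel ℝ Torus2) (α β : Measure Torus2) : Prop :=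
  ∃ c : ℝ → FiniteMeasure Torus2, ContinuousOn c (Icc (-T) T) ∧
    (∀ᵐ t ∂(volume.restrict (Ioo (-T) T)), κ t = (c t : Measure Torus2)) ∧
    (c (-T) : Measure Torus2) = α ∧ (c T : Measure Torus2) = β

end

/-!
The energy of an admissible pair is studied without its flux. By Young's inequality and the
continuity equation, a pair whose flux term is `A` satisfies, for every smooth `f`,
`∫ f_t dμ_t - ∫ f_s dμ_s - ∫∫ ∂_t f dμ dr ≤ A / 2 + ∫∫ |∇f|² / 2 dμ dr`, and conversely this family
of inequalities gives back a flux of squared `L²(μ)` norm at most `A`, by the Riesz representation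
theorem. In the same way the irrigation cost `∑ μ_t({x})^{1/2}` is replaced by
`∫ μ_t({x})^{-1/2} dμ_t(x)`, which agrees with it on discrete measures and is infinite on all others
(`discrete_of_sqrtMass_ne_top`). A curve of probability measures subject to the two bounds is a flow
(`IsFlow`); `IsFlow.exists_admissible` and `IsAdmissible.exists_flow` translate back and forth, so
that minimizing over admissible pairs is minimizing over flows.

Existence is the direct method. The functional `∫ ν({x})^{-1/2} dν(x)` is a supremum of weakly
continuous ones (`lowerSemicontinuous_sqrtMass`), the dual inequalities are stable under weak limits,
and they make flows equi-`1/2`-Hölder against trigonometric monomials, which embed the space of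
probability measures of the torus into a product of lines (`isClosedEmbedding_fourierEmb`). Hence
flows of bounded energy are compact (`exists_limit_flow`).

For the upper bound, flows can be concatenated (`IsFlow.concat`), and finitely many particles moving
along straight lines form a flow (`exists_segment_flow`) whose irrigation cost is at most the time
times the square root of the number of particles. Moving mass from the dyadic grid of level `k + 1`
to that of level `k` in times that grow geometrically with the mesh size joins arbitrarily fine
discretizations of a measure to its discretization at level `k`, at a cost of order `2 ^ k τ` and an
action of order `4 ^ (-k) / τ` in a time of order `τ` (`flowJoined_gridApprox_add`). Between the two
grids of level `k`, a transport plan is followed along shortest lines; Carathéodory's theorem thins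
it out to about `2 · 4 ^ k` particles (`exists_sparse_plan`), so that the irrigation cost is of order
`2 ^ k T`. With `τ = η T / 6` and `2 ^ k` of order `max (1, T^{-2/3})`, everything other than the
transport cost is of order `max (T, T^{1/3}) / η`; compactness removes the discretization of the
end points (`exists_flow_of_plan`).
-/

open Filter Topology

noncomputable section

/-! ### Lower semicontinuity of the irrigation cost -/

section SqrtMass

theorem antitone_rpow_neg_half : Antitone fun a : ℝ≥0∞ => a ^ (-(1 / 2) : ℝ) := by
  intro a b hab
  simp only [ENNReal.rpow_neg]
  exact ENNReal.inv_le_inv.2 (ENNReal.rpow_le_rpow hab (by norm_num))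

variable {X : Type*} [MetricSpace X]

/-- A continuous family of kernels decreasing to the indicator of the diagonal. -/
def diagKernel (n : ℕ) : C(X × X, ℝ) where
  toFun p := 1 / (n + 1 : ℝ) + max 0 (1 - (n + 1 : ℝ) * dist p.1 p.2)
  continuous_toFun := by fun_prop

theorem diagKernel_lower (n : ℕ) (p : X × X) : 1 / (n + 1 : ℝ) ≤ diagKernel n p :=
  le_add_of_nonneg_right (le_max_left _ _)

theorem antitone_diagKernel (p : X × X) : Antitone fun n : ℕ => diagKernel n p := by
  intro m n hmn
  have h : (m : ℝ) ≤ n := by exact_mod_cast hmn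
  have h0 : (0 : ℝ) ≤ m := by positivity
  exact add_le_add (one_div_le_one_div_of_le (by positivity) (by linarith))
    (max_le_max le_rfl (by nlinarith [dist_nonneg (x := p.1) (y := p.2)]))

variable [CompactSpace X] [MeasurableSpace X] [BorelSpace X]

/-- The integral of a continuous function depends jointly continuously on the function (in the sup
norm) and on the probability measure (in the weak topology). -/
theorem continuous_integral_pair :
    Continuous fun p : C(X, ℝ) × ProbabilityMeasure X => ∫ y, p.1 y ∂(p.2 : Measure X) := by
  rw [continuous_iff_continuousAt]
  rintro ⟨f₀, ν₀⟩
  have h1 : Tendsto (fun p : C(X, ℝ) × ProbabilityMeasure X => ∫ y, (p.1 - f₀) y ∂(p.2 : Measure X))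
      (𝓝 (f₀, ν₀)) (𝓝 0) := by
    have hle : ∀ p : C(X, ℝ) × ProbabilityMeasure X,
        ‖∫ y, (p.1 - f₀) y ∂(p.2 : Measure X)‖ ≤ ‖p.1 - f₀‖ := by
      intro p
      have := norm_integral_le_of_norm_le_const (μ := (p.2 : Measure X)) (f := ⇑(p.1 - f₀))
        (C := ‖p.1 - f₀‖) (Eventually.of_forall fun y => (p.1 - f₀).norm_coe_le_norm y)
      simpa using this
    refine squeeze_zero_norm hle ?_
    have : Continuous fun p : C(X, ℝ) × ProbabilityMeasure X => ‖p.1 - f₀‖ := by fun_prop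
    simpa using this.tendsto (f₀, ν₀)
  have h2 : Tendsto (fun p : C(X, ℝ) × ProbabilityMeasure X => ∫ y, f₀ y ∂(p.2 : Measure X))
      (𝓝 (f₀, ν₀)) (𝓝 (∫ y, f₀ y ∂(ν₀ : Measure X))) :=
    ((ProbabilityMeasure.continuous_integral_continuousMap f₀).comp continuous_snd).tendsto
      (f₀, ν₀)
  have h3 := h1.add h2
  rw [zero_add] at h3
  refine h3.congr fun p => ?_
  have hint : ∀ g : C(X, ℝ), Integrable (⇑g) (p.2 : Measure X) := fun g =>
    g.continuous.integrable_of_hasCompactSupport (HasCompactSupport.of_compactSpace g)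
  rw [← integral_add (hint _) (hint _)]
  simp

/-- The mass of `ν` seen from `x` at scale `1 / (n + 1)`. -/
def localMass (n : ℕ) (ν : ProbabilityMeasure X) (x : X) : ℝ :=
  ∫ y, diagKernel n (x, y) ∂(ν : Measure X)

theorem continuous_localMass (n : ℕ) :
    Continuous fun p : ProbabilityMeasure X × X => localMass n p.1 p.2 := by
  have h : Continuous fun p : ProbabilityMeasure X × X =>
      (((diagKernel (X := X) n).curry p.2, p.1) : C(X, ℝ) × ProbabilityMeasure X) := by
    fun_prop
  exact continuous_integral_pair.comp h

theorem integrable_continuousMap (ν : ProbabilityMeasure X) (g : C(X, ℝ)) :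
    Integrable (⇑g) (ν : Measure X) :=
  g.continuous.integrable_of_hasCompactSupport (HasCompactSupport.of_compactSpace g)

theorem integrable_diagKernel (n : ℕ) (ν : ProbabilityMeasure X) (x : X) :
    Integrable (fun y => diagKernel n (x, y)) (ν : Measure X) :=
  integrable_continuousMap ν ((diagKernel (X := X) n).curry x)

theorem localMass_pos (n : ℕ) (ν : ProbabilityMeasure X) (x : X) : 0 < localMass n ν x := by
  have h : ∫ _y : X, 1 / (n + 1 : ℝ) ∂(ν : Measure X) ≤ localMass n ν x :=
    integral_mono (integrable_const _) (integrable_diagKernel n ν x)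
      fun y => diagKernel_lower n (x, y)
  rw [integral_const, probReal_univ, one_smul] at h
  exact lt_of_lt_of_le (by positivity) h

theorem antitone_localMass (ν : ProbabilityMeasure X) (x : X) :
    Antitone fun n : ℕ => localMass n ν x := fun _ _ hmn =>
  integral_mono (integrable_diagKernel _ ν x) (integrable_diagKernel _ ν x)
    fun y => antitone_diagKernel (x, y) hmn

theorem tendsto_localMass (ν : ProbabilityMeasure X) (x : X) :
    Tendsto (fun n : ℕ => localMass n ν x) atTop (𝓝 ((ν : Measure X).real {x})) := by
  have h : Tendsto (fun n : ℕ => ∫ y, diagKernel n (x, y) ∂(ν : Measure X)) atTop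
      (𝓝 (∫ y, ({x} : Set X).indicator (fun _ => (1 : ℝ)) y ∂(ν : Measure X))) := by
    refine tendsto_integral_of_dominated_convergence (fun _ => 2)
      (fun n => (integrable_diagKernel n ν x).aestronglyMeasurable) (integrable_const _) ?_ ?_
    · intro n
      refine Eventually.of_forall fun y => ?_
      have h1 : diagKernel n (x, y) ≤ diagKernel 0 (x, y) := antitone_diagKernel (x, y) n.zero_le
      have h2 : diagKernel 0 (x, y) ≤ 2 := by
        simp only [diagKernel, ContinuousMap.coe_mk, Nat.cast_zero, zero_add]
        have : max 0 (1 - 1 * dist x y) ≤ 1 :=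
          max_le zero_le_one (by linarith [dist_nonneg (x := x) (y := y)])
        linarith
      have h3 : 0 ≤ diagKernel n (x, y) := le_trans (by positivity) (diagKernel_lower n (x, y))
      rw [Real.norm_of_nonneg h3]
      exact h1.trans h2
    · refine Eventually.of_forall fun y => ?_
      have hone : Tendsto (fun n : ℕ => 1 / ((n : ℝ) + 1)) atTop (𝓝 0) :=
        tendsto_one_div_add_atTop_nhds_zero_nat
      by_cases hxy : y = x
      · subst hxy
        simp only [diagKernel, ContinuousMap.coe_mk, dist_self, mul_zero, sub_zero]
        simpa using hone.add_const 1
      · have hd : 0 < dist x y := dist_pos.2 (Ne.symm hxy)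
        rw [indicator_of_notMem (by simpa using hxy)]
        obtain ⟨N, hN⟩ := exists_nat_gt (1 / dist x y)
        refine hone.congr' ?_
        filter_upwards [eventually_ge_atTop N] with n hn
        have hn' : (N : ℝ) ≤ n := by exact_mod_cast hn
        have h4 : 1 < N * dist x y := by rwa [div_lt_iff₀ hd] at hN
        simp only [diagKernel, ContinuousMap.coe_mk]
        rw [max_eq_left (by nlinarith), add_zero]
  simpa [localMass, integral_indicator_one] using h

/-- The functional `ν ↦ ∫ ν({x})^{-1/2} dν(x)`. It equals `∑ ν({x})^{1/2}` on discrete measures and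
is infinite on measures with a diffuse part. -/
def sqrtMass (ν : Measure X) : ℝ≥0∞ := ∫⁻ x, (ν {x}) ^ (-(1 / 2) : ℝ) ∂ν

/-- The weakly continuous approximation of `sqrtMass` at scale `1 / (n + 1)`. -/
def approxSqrtMass (n : ℕ) (ν : ProbabilityMeasure X) : ℝ :=
  ∫ x, (localMass n ν x) ^ (-(1 / 2) : ℝ) ∂(ν : Measure X)

theorem continuous_localMass_rpow (n : ℕ) :
    Continuous fun p : ProbabilityMeasure X × X => localMass n p.1 p.2 ^ (-(1 / 2) : ℝ) :=
  (continuous_localMass n).rpow_const fun p => Or.inl (localMass_pos n p.1 p.2).ne'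

theorem continuous_approxSqrtMass (n : ℕ) : Continuous (approxSqrtMass (X := X) n) := by
  let K : C(ProbabilityMeasure X × X, ℝ) := ⟨_, continuous_localMass_rpow n⟩
  have h : Continuous fun ν : ProbabilityMeasure X => ((K.curry ν, ν) : C(X, ℝ) × _) := by
    fun_prop
  exact continuous_integral_pair.comp h

theorem ofReal_approxSqrtMass (n : ℕ) (ν : ProbabilityMeasure X) :
    ENNReal.ofReal (approxSqrtMass n ν) =
      ∫⁻ x, ENNReal.ofReal (localMass n ν x) ^ (-(1 / 2) : ℝ) ∂(ν : Measure X) := by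
  let K : C(ProbabilityMeasure X × X, ℝ) := ⟨_, continuous_localMass_rpow n⟩
  rw [approxSqrtMass, ofReal_integral_eq_lintegral_ofReal]
  · refine lintegral_congr fun x => ?_
    rw [ENNReal.ofReal_rpow_of_pos (localMass_pos n ν x)]
  · exact integrable_continuousMap ν (K.curry ν)
  · exact Eventually.of_forall fun x => Real.rpow_nonneg (localMass_pos n ν x).le _

theorem measurable_localMass (n : ℕ) (ν : ProbabilityMeasure X) : Measurable (localMass n ν) :=
  ((continuous_localMass n).comp (Continuous.prodMk_right ν)).measurable

/-- Monotone convergence. At a point without mass the exponent `-1/2` gives the value `⊤`, which is also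
the limit of the approximations. -/
theorem sqrtMass_eq_iSup (ν : ProbabilityMeasure X) :
    sqrtMass (ν : Measure X) = ⨆ n : ℕ, ENNReal.ofReal (approxSqrtMass n ν) := by
  simp_rw [ofReal_approxSqrtMass]
  rw [← lintegral_iSup]
  · refine lintegral_congr fun x => ?_
    have h1 : Tendsto (fun n : ℕ => ENNReal.ofReal (localMass n ν x) ^ (-(1 / 2) : ℝ)) atTop
        (𝓝 (((ν : Measure X) {x}) ^ (-(1 / 2) : ℝ))) := by
      have := ENNReal.tendsto_ofReal (tendsto_localMass ν x)
      rw [ofReal_measureReal] at this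
      exact (ENNReal.continuous_rpow_const.tendsto _).comp this
    refine tendsto_nhds_unique h1 (tendsto_atTop_iSup ?_)
    intro m n hmn
    exact antitone_rpow_neg_half
      (ENNReal.ofReal_le_ofReal (antitone_localMass ν x hmn))
  · intro n
    exact ((measurable_localMass n ν).ennreal_ofReal).pow_const _
  · intro m n hmn x
    exact antitone_rpow_neg_half
      (ENNReal.ofReal_le_ofReal (antitone_localMass ν x hmn))

/-- `sqrtMass` is a supremum of weakly continuous functionals, hence weakly lower semicontinuous. -/
theorem lowerSemicontinuous_sqrtMass :
    LowerSemicontinuous fun ν : ProbabilityMeasure X => sqrtMass (ν : Measure X) := by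
  simp_rw [sqrtMass_eq_iSup]
  exact lowerSemicontinuous_iSup fun n =>
    (ENNReal.continuous_ofReal.comp (continuous_approxSqrtMass n)).lowerSemicontinuous

end SqrtMass

theorem rpow_neg_half_mul_self {a : ℝ≥0∞} (h0 : a ≠ 0) (h1 : a ≠ ⊤) :
    a ^ (-(1 / 2) : ℝ) * a = a ^ (1 / 2 : ℝ) := by
  nth_rewrite 2 [← ENNReal.rpow_one a]
  rw [← ENNReal.rpow_add _ _ h0 h1]
  congr 1
  norm_num

theorem rpow_neg_half_mul_self_le (a : ℝ≥0∞) (h1 : a ≠ ⊤) :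
    a ^ (-(1 / 2) : ℝ) * a ≤ a ^ (1 / 2 : ℝ) := by
  rcases eq_or_ne a 0 with rfl | h0
  · simp
  · exact (rpow_neg_half_mul_self h0 h1).le

/-- Only an inequality is needed here, so the atoms may be listed with repetitions. -/
theorem sqrtMass_le_tsum {ν : Measure Torus2} [IsFiniteMeasure ν] (h : IsDiscreteMeasure ν) :
    sqrtMass ν ≤ ∑' x : Torus2, (ν {x}) ^ (1 / 2 : ℝ) := by
  obtain ⟨φ, X, hν⟩ := h
  have hS : (range X).Countable := countable_range X
  have hc : ∀ᵐ x ∂ν, x ∈ range X := by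
    rw [hν]
    refine (Measure.ae_sum_iff' (p := (· ∈ range X)) hS.measurableSet).2 ?_
    intro i
    refine Measure.ae_smul_measure ?_ _
    exact (ae_dirac_iff (p := (· ∈ range X)) hS.measurableSet).2 (mem_range_self i)
  rw [sqrtMass, ← Measure.restrict_eq_self_of_ae_mem hc, lintegral_countable _ hS]
  rw [Measure.restrict_eq_self_of_ae_mem hc]
  refine le_trans (ENNReal.tsum_le_tsum fun x : range X => ?_)
    (ENNReal.tsum_comp_le_tsum_of_injective (Subtype.val_injective (p := (· ∈ range X)))
      fun x => (ν {x}) ^ (1 / 2 : ℝ))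
  exact rpow_neg_half_mul_self_le _ (measure_ne_top _ _)

/-- If `sqrtMass ν` is finite, the set of points without mass is `ν`-null, and `ν` is carried by its
countably many atoms. -/
theorem discrete_of_sqrtMass_ne_top {ν : Measure Torus2} [IsFiniteMeasure ν]
    (h : sqrtMass ν ≠ ⊤) :
    IsDiscreteMeasure ν ∧ ∑' x : Torus2, (ν {x}) ^ (1 / 2 : ℝ) ≤ sqrtMass ν := by
  set S : Set Torus2 := {x | ν {x} ≠ 0} with hSdef
  have hS : S.Countable := by
    have := Measure.countable_meas_pos_of_disjoint_iUnion (μ := ν)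
      (As := fun x : Torus2 => ({x} : Set Torus2)) (fun x => measurableSet_singleton x)
      (fun x y hxy => by simpa [Function.onFun] using hxy)
    simpa [hSdef, pos_iff_ne_zero] using this
  have hnull : ν Sᶜ = 0 := by
    by_contra hne
    apply h
    rw [eq_top_iff]
    calc (⊤ : ℝ≥0∞) = ⊤ * ν Sᶜ := (ENNReal.top_mul hne).symm
      _ = ∫⁻ x in Sᶜ, ⊤ ∂ν := by rw [setLIntegral_const]
      _ ≤ ∫⁻ x in Sᶜ, (ν {x}) ^ (-(1 / 2) : ℝ) ∂ν := by
        refine setLIntegral_mono' hS.measurableSet.compl fun x hx => ?_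
        have : ν {x} = 0 := by simpa [hSdef] using hx
        simp [this]
      _ ≤ sqrtMass ν := setLIntegral_le_lintegral _ _
  have hae : ∀ᵐ x ∂ν, x ∈ S := by
    rw [ae_iff]; exact hnull
  constructor
  · rcases S.eq_empty_or_nonempty with hE | hne
    · refine ⟨fun _ => 0, fun _ => 0, ?_⟩
      rw [hE, compl_empty] at hnull
      rw [Measure.measure_univ_eq_zero.1 hnull]
      ext s _
      simp
    · obtain ⟨X, hX⟩ := hS.exists_eq_range hne
      -- disjointification keeps each atom only at its first occurrence in the enumeration
      set A : ℕ → Set Torus2 := disjointed fun n => {X n} with hA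
      have hAm : ∀ n, MeasurableSet (A n) := fun n =>
        MeasurableSet.disjointed (fun i => measurableSet_singleton (X i)) n
      refine ⟨fun n => ν (A n), X, ?_⟩
      have hU : ⋃ n, A n = S := by
        rw [hA, iUnion_disjointed, hX]
        ext x
        simp [eq_comm]
      rw [← Measure.restrict_eq_self_of_ae_mem hae]
      conv_lhs => rw [← hU, Measure.restrict_iUnion (disjoint_disjointed _) hAm]
      rw [Measure.restrict_eq_self_of_ae_mem hae]
      congr 1
      funext n
      rcases subset_singleton_iff_eq.1 (disjointed_subset (fun n => ({X n} : Set Torus2)) n)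
        with h0 | h1
      · simp only [hA, h0]
        simp
      · simp only [hA, h1, Measure.restrict_singleton]
  · have hsupp : ∑' x : Torus2, (ν {x}) ^ (1 / 2 : ℝ) = ∑' x : S, (ν {(x : Torus2)}) ^ (1 / 2 : ℝ) := by
      refine (tsum_subtype_eq_of_support_subset (s := S) fun x hx => ?_).symm
      intro h0
      simp [h0] at hx
    rw [hsupp]
    conv_rhs => rw [sqrtMass, ← Measure.restrict_eq_self_of_ae_mem hae, lintegral_countable _ hS]
    rw [Measure.restrict_eq_self_of_ae_mem hae]
    exact ENNReal.tsum_le_tsum fun x : S =>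
      (rpow_neg_half_mul_self x.2 (measure_ne_top _ _)).ge

/-! ### Smooth functions on the torus -/

/-- `f` is smooth on `ℝ × Q`: its periodic lift to `ℝ × ℝ²` is smooth. -/
def SmoothOnTorus (f : ℝ × Torus2 → ℝ) : Prop :=
  ContDiff ℝ ∞ fun p : ℝ × EuclideanSpace ℝ (Fin 2) => f (p.1, torusMk p.2)

/-- The periodic lift of a function on `ℝ × Q` to `ℝ × ℝ²`. -/
def torusLift (f : ℝ × Torus2 → ℝ) (p : ℝ × EuclideanSpace ℝ (Fin 2)) : ℝ := f (p.1, torusMk p.2)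

theorem isOpenQuotientMap_torusMk : IsOpenQuotientMap torusMk := by
  have h1 : IsOpenQuotientMap (Pi.map fun (_ : Fin 2) (y : ℝ) => (y : UnitAddCircle)) :=
    IsOpenQuotientMap.piMap fun _ => QuotientAddGroup.isOpenQuotientMap_mk
  exact h1.comp (EuclideanSpace.equiv (Fin 2) ℝ).toHomeomorph.isOpenQuotientMap

theorem continuous_torusMk : Continuous torusMk := isOpenQuotientMap_torusMk.continuous

theorem isOpenQuotientMap_prod_torusMk :
    IsOpenQuotientMap (Prod.map (id : ℝ → ℝ) torusMk) :=
  IsOpenQuotientMap.id.prodMap isOpenQuotientMap_torusMk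

theorem exists_torusMk_eq (x : Torus2) : ∃ y, torusMk y = x :=
  isOpenQuotientMap_torusMk.surjective x

theorem torusMk_add_single (y : EuclideanSpace ℝ (Fin 2)) (i : Fin 2) (h : ℝ) :
    torusMk y + Pi.single i (h : UnitAddCircle) = torusMk (y + h • EuclideanSpace.single i 1) := by
  funext j
  by_cases hij : j = i
  · subst hij
    simp [torusMk]
  · simp [torusMk, hij]

namespace SmoothOnTorus

variable {f g : ℝ × Torus2 → ℝ}

theorem differentiable (hf : SmoothOnTorus f) : Differentiable ℝ (torusLift f) :=
  ContDiff.differentiable (n := ∞) hf (by simp)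

theorem continuous_fderiv (hf : SmoothOnTorus f) : Continuous (fderiv ℝ (torusLift f)) :=
  ContDiff.continuous_fderiv (n := ∞) hf (by simp)

theorem continuous (hf : SmoothOnTorus f) : Continuous f :=
  isOpenQuotientMap_prod_torusMk.isQuotientMap.continuous_iff.2 (ContDiff.continuous (n := ∞) hf)

theorem hasDerivAt_time (hf : SmoothOnTorus f) (t : ℝ) (y : EuclideanSpace ℝ (Fin 2)) :
    HasDerivAt (fun s => f (s, torusMk y)) (fderiv ℝ (torusLift f) (t, y) (1, 0)) t := by
  have h1 : HasDerivAt (fun s : ℝ => (s, y)) ((1 : ℝ), (0 : EuclideanSpace ℝ (Fin 2))) t :=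
    (hasDerivAt_id t).prodMk (hasDerivAt_const t y)
  exact (hf.differentiable (t, y)).hasFDerivAt.comp_hasDerivAt t h1

theorem timeDeriv_eq (hf : SmoothOnTorus f) (t : ℝ) (y : EuclideanSpace ℝ (Fin 2)) :
    timeDeriv f (t, torusMk y) = fderiv ℝ (torusLift f) (t, y) (1, 0) :=
  (hf.hasDerivAt_time t y).deriv

theorem hasDerivAt_space (hf : SmoothOnTorus f) (t : ℝ) (y : EuclideanSpace ℝ (Fin 2))
    (i : Fin 2) :
    HasDerivAt (fun h : ℝ => f (t, torusMk y + Pi.single i (h : UnitAddCircle)))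
      (fderiv ℝ (torusLift f) (t, y) (0, EuclideanSpace.single i 1)) 0 := by
  have h1 : HasDerivAt (fun h : ℝ => (t, y + h • EuclideanSpace.single i (1 : ℝ)))
      ((0 : ℝ), EuclideanSpace.single i (1 : ℝ)) 0 := by
    refine (hasDerivAt_const (0 : ℝ) t).prodMk ?_
    simpa using ((hasDerivAt_id (0 : ℝ)).smul_const (EuclideanSpace.single i (1 : ℝ))).const_add y
  have h2 : HasFDerivAt (torusLift f) (fderiv ℝ (torusLift f) (t, y))
      ((fun h : ℝ => (t, y + h • EuclideanSpace.single i (1 : ℝ))) 0) := by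
    simpa using (hf.differentiable (t, y)).hasFDerivAt
  have h3 := h2.comp_hasDerivAt 0 h1
  simp_rw [torusMk_add_single]
  exact h3

theorem horGrad_eq (hf : SmoothOnTorus f) (t : ℝ) (y : EuclideanSpace ℝ (Fin 2)) (i : Fin 2) :
    horGrad f (t, torusMk y) i =
      fderiv ℝ (torusLift f) (t, y) (0, EuclideanSpace.single i 1) :=
  (hf.hasDerivAt_space t y i).deriv

theorem continuous_timeDeriv (hf : SmoothOnTorus f) : Continuous (timeDeriv f) := by
  refine isOpenQuotientMap_prod_torusMk.isQuotientMap.continuous_iff.2 ?_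
  have : timeDeriv f ∘ Prod.map id torusMk =
      fun p => fderiv ℝ (torusLift f) p (1, 0) := by
    funext p
    exact hf.timeDeriv_eq p.1 p.2
  rw [this]
  exact hf.continuous_fderiv.clm_apply continuous_const

theorem continuous_horGrad (hf : SmoothOnTorus f) : Continuous (horGrad f) := by
  refine isOpenQuotientMap_prod_torusMk.isQuotientMap.continuous_iff.2 ?_
  refine (PiLp.continuous_toLp 2 _).comp (continuous_pi fun i => ?_)
  have : (fun p : ℝ × EuclideanSpace ℝ (Fin 2) => horGrad f (p.1, torusMk p.2) i) =
      fun p => fderiv ℝ (torusLift f) p (0, EuclideanSpace.single i 1) := by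
    funext p
    exact hf.horGrad_eq p.1 p.2 i
  have h2 := hf.continuous_fderiv.clm_apply
    (continuous_const (y := ((0 : ℝ), EuclideanSpace.single i (1 : ℝ))))
  rw [← this] at h2
  exact h2

/-- The chain rule along a curve with constant velocity. -/
theorem hasDerivAt_line (hf : SmoothOnTorus f) (x v : EuclideanSpace ℝ (Fin 2)) (a t : ℝ) :
    HasDerivAt (fun r => f (r, torusMk (x + (r - a) • v)))
      (timeDeriv f (t, torusMk (x + (t - a) • v)) +
        inner ℝ (horGrad f (t, torusMk (x + (t - a) • v))) v) t := by
  have h1 : HasDerivAt (fun r : ℝ => (r, x + (r - a) • v)) ((1 : ℝ), v) t := by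
    refine (hasDerivAt_id t).prodMk ?_
    simpa using (((hasDerivAt_id t).sub_const a).smul_const v).const_add x
  have h3 := (hf.differentiable (t, x + (t - a) • v)).hasFDerivAt.comp_hasDerivAt t h1
  refine HasDerivAt.congr_deriv h3 ?_
  have hv : ((1 : ℝ), v) = (1, 0) + ∑ i, v i • ((0 : ℝ), EuclideanSpace.single i (1 : ℝ)) := by
    refine Prod.ext ?_ ?_
    · simp
    · ext j
      fin_cases j <;> simp
  rw [hv, map_add, map_sum, hf.timeDeriv_eq]
  congr 1
  rw [PiLp.inner_apply]
  refine Finset.sum_congr rfl fun i _ => ?_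
  rw [map_smul, hf.horGrad_eq]
  simp

theorem add (hf : SmoothOnTorus f) (hg : SmoothOnTorus g) : SmoothOnTorus (f + g) :=
  ContDiff.add hf hg

theorem const_smul (c : ℝ) (hf : SmoothOnTorus f) : SmoothOnTorus (c • f) :=
  contDiff_const.mul hf

theorem of_space {u : Torus2 → ℝ}
    (hu : ContDiff ℝ ∞ fun y : EuclideanSpace ℝ (Fin 2) => u (torusMk y)) :
    SmoothOnTorus fun z => u z.2 :=
  hu.comp contDiff_snd

theorem mul_time {ψ : ℝ → ℝ} (hψ : ContDiff ℝ ∞ ψ) (hf : SmoothOnTorus f) :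
    SmoothOnTorus fun z => ψ z.1 * f z :=
  ContDiff.mul (hψ.comp contDiff_fst) hf

theorem timeDeriv_add (hf : SmoothOnTorus f) (hg : SmoothOnTorus g) :
    timeDeriv (f + g) = timeDeriv f + timeDeriv g := by
  funext ⟨t, x⟩
  obtain ⟨y, rfl⟩ := exists_torusMk_eq x
  exact deriv_add (hf.hasDerivAt_time t y).differentiableAt
    (hg.hasDerivAt_time t y).differentiableAt

theorem horGrad_add (hf : SmoothOnTorus f) (hg : SmoothOnTorus g) :
    horGrad (f + g) = horGrad f + horGrad g := by
  funext ⟨t, x⟩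
  obtain ⟨y, rfl⟩ := exists_torusMk_eq x
  ext i
  exact deriv_add (hf.hasDerivAt_space t y i).differentiableAt
    (hg.hasDerivAt_space t y i).differentiableAt

theorem timeDeriv_mul_time {ψ : ℝ → ℝ} (hψ : ContDiff ℝ ∞ ψ) (hf : SmoothOnTorus f)
    (z : ℝ × Torus2) :
    timeDeriv (fun z => ψ z.1 * f z) z = deriv ψ z.1 * f z + ψ z.1 * timeDeriv f z := by
  obtain ⟨t, x⟩ := z
  obtain ⟨y, rfl⟩ := exists_torusMk_eq x
  exact deriv_fun_mul (hψ.differentiable (by simp) t) (hf.hasDerivAt_time t y).differentiableAt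

end SmoothOnTorus

theorem timeDeriv_const_smul (c : ℝ) (f : ℝ × Torus2 → ℝ) :
    timeDeriv (c • f) = c • timeDeriv f := by
  funext z
  exact deriv_const_mul_field c

theorem horGrad_const_smul (c : ℝ) (f : ℝ × Torus2 → ℝ) :
    horGrad (c • f) = c • horGrad f := by
  funext z
  ext i
  exact deriv_const_mul_field c

theorem horGrad_mul_time (ψ : ℝ → ℝ) (f : ℝ × Torus2 → ℝ) (z : ℝ × Torus2) :
    horGrad (fun z => ψ z.1 * f z) z = ψ z.1 • horGrad f z := by
  ext i
  exact deriv_const_mul_field (ψ z.1)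

theorem timeDeriv_space (u : Torus2 → ℝ) : timeDeriv (fun z => u z.2) = 0 := by
  funext z
  simp [timeDeriv]

/-! ### Flows: dual form of the action, concatenation, straight lines -/

theorem integrable_of_continuous {g : Torus2 → ℝ} (hg : Continuous g) (ν : Measure Torus2)
    [IsFiniteMeasure ν] : Integrable g ν :=
  hg.integrable_of_hasCompactSupport (HasCompactSupport.of_compactSpace g)

/-- Along a weakly continuous curve of measures, slice integrals depend continuously on time. -/
theorem continuous_slice_integral {c : ℝ → ProbabilityMeasure Torus2} (hc : Continuous c)
    {g : ℝ × Torus2 → ℝ} (hg : Continuous g) :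
    Continuous fun t => ∫ x, g (t, x) ∂(c t : Measure Torus2) := by
  let K : C(ℝ × Torus2, ℝ) := ⟨g, hg⟩
  have h : Continuous fun t : ℝ => ((K.curry t, c t) : C(Torus2, ℝ) × _) := by fun_prop
  exact continuous_integral_pair.comp h

/-- The excess of `f` along the curve `c` between the times `s` and `t`. The Benamou–Brenier action
of `c` on `[s, t]` is twice the supremum of the excess over all smooth `f`. -/
def flowExcess (f : ℝ × Torus2 → ℝ) (c : ℝ → ProbabilityMeasure Torus2) (s t : ℝ) : ℝ :=
  ∫ x, f (t, x) ∂(c t : Measure Torus2) - ∫ x, f (s, x) ∂(c s : Measure Torus2) -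
    (∫ r in s..t, ∫ x, timeDeriv f (r, x) ∂(c r : Measure Torus2)) -
    (∫ r in s..t, ∫ x, ‖horGrad f (r, x)‖ ^ 2 ∂(c r : Measure Torus2)) / 2

/-- A weakly continuous curve of probability measures on `[a, b]` whose irrigation cost
`∫ ∑ μ_t({x})^{1/2} dt` is at most `P` and whose Benamou–Brenier action is at most `A`. The action is
expressed by duality, which makes the notion stable under weak limits and concatenation, and does
not mention the flux. Only the values of `c` on `[a, b]` matter; continuity on all of `ℝ` is a
convenience. -/
structure IsFlow (a b : ℝ) (c : ℝ → ProbabilityMeasure Torus2) (P : ℝ≥0∞) (A : ℝ) : Prop where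
  continuous : Continuous c
  perimeter : ∫⁻ t in Ioo a b, sqrtMass (c t : Measure Torus2) ≤ P
  action : ∀ f, SmoothOnTorus f → ∀ s t, a ≤ s → s ≤ t → t ≤ b → flowExcess f c s t ≤ A / 2

theorem continuous_slice_timeDeriv {c : ℝ → ProbabilityMeasure Torus2} (hc : Continuous c)
    {f : ℝ × Torus2 → ℝ} (hf : SmoothOnTorus f) :
    Continuous fun t => ∫ x, timeDeriv f (t, x) ∂(c t : Measure Torus2) :=
  continuous_slice_integral hc hf.continuous_timeDeriv

theorem continuous_slice_horGrad_sq {c : ℝ → ProbabilityMeasure Torus2} (hc : Continuous c)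
    {f : ℝ × Torus2 → ℝ} (hf : SmoothOnTorus f) :
    Continuous fun t => ∫ x, ‖horGrad f (t, x)‖ ^ 2 ∂(c t : Measure Torus2) :=
  continuous_slice_integral (g := fun z => ‖horGrad f z‖ ^ 2) hc (hf.continuous_horGrad.norm.pow 2)

theorem flowExcess_add {c : ℝ → ProbabilityMeasure Torus2} (hc : Continuous c)
    {f : ℝ × Torus2 → ℝ} (hf : SmoothOnTorus f) (s t u : ℝ) :
    flowExcess f c s t + flowExcess f c t u = flowExcess f c s u := by
  have h1 := continuous_slice_timeDeriv hc hf
  have h2 := continuous_slice_horGrad_sq hc hf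
  have e1 := intervalIntegral.integral_add_adjacent_intervals
    (h1.intervalIntegrable (μ := volume) s t) (h1.intervalIntegrable (μ := volume) t u)
  have e2 := intervalIntegral.integral_add_adjacent_intervals
    (h2.intervalIntegrable (μ := volume) s t) (h2.intervalIntegrable (μ := volume) t u)
  rw [flowExcess, flowExcess, flowExcess, ← e1, ← e2]
  ring

theorem flowExcess_congr {c c' : ℝ → ProbabilityMeasure Torus2} (f : ℝ × Torus2 → ℝ) {s t : ℝ}
    (hst : s ≤ t) (h : ∀ r ∈ Icc s t, c r = c' r) : flowExcess f c s t = flowExcess f c' s t := by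
  rw [flowExcess, flowExcess, h t ⟨hst, le_rfl⟩, h s ⟨le_rfl, hst⟩]
  congr 1
  · congr 1
    refine intervalIntegral.integral_congr fun r hr => ?_
    rw [uIcc_of_le hst] at hr
    simp only [h r hr]
  · congr 1
    refine intervalIntegral.integral_congr fun r hr => ?_
    rw [uIcc_of_le hst] at hr
    simp only [h r hr]

theorem flowExcess_self (f : ℝ × Torus2 → ℝ) (c : ℝ → ProbabilityMeasure Torus2) (s : ℝ) :
    flowExcess f c s s = 0 := by
  simp [flowExcess]

theorem IsFlow.action_nonneg {a b : ℝ} {c : ℝ → ProbabilityMeasure Torus2} {P : ℝ≥0∞} {A : ℝ}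
    (h : IsFlow a b c P A) (hab : a ≤ b) : 0 ≤ A := by
  have h0 : SmoothOnTorus 0 := contDiff_const
  have := h.action 0 h0 a a le_rfl le_rfl hab
  rw [flowExcess_self] at this
  linarith

/-- Concatenation of flows. -/
theorem IsFlow.concat {a b d : ℝ} {c c' : ℝ → ProbabilityMeasure Torus2} {P P' : ℝ≥0∞} {A A' : ℝ}
    (hab : a ≤ b) (hbd : b ≤ d) (h : IsFlow a b c P A) (h' : IsFlow b d c' P' A')
    (hc : c b = c' b) : IsFlow a d (fun t => if t ≤ b then c t else c' t) (P + P') (A + A') := by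
  set C : ℝ → ProbabilityMeasure Torus2 := fun t => if t ≤ b then c t else c' t with hC
  have hl : ∀ r, r ≤ b → C r = c r := fun r hr => if_pos hr
  have hr : ∀ r, b ≤ r → C r = c' r := by
    intro r hr
    rcases hr.eq_or_lt with rfl | hlt
    · rw [hl b le_rfl, hc]
    · exact if_neg (not_le.2 hlt)
  have hcont : Continuous C :=
    Continuous.if_le h.continuous h'.continuous continuous_id continuous_const
      fun t ht => by rw [ht, hc]
  have hA := h.action_nonneg hab
  have hA' := h'.action_nonneg hbd
  refine ⟨hcont, ?_, ?_⟩
  · have hsub : Ioo a d ⊆ Ioc a b ∪ Ioo b d := by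
      intro t ht
      rcases le_or_gt t b with h1 | h1
      · exact Or.inl ⟨ht.1, h1⟩
      · exact Or.inr ⟨h1, ht.2⟩
    calc ∫⁻ t in Ioo a d, sqrtMass (C t : Measure Torus2)
        ≤ ∫⁻ t in Ioc a b ∪ Ioo b d, sqrtMass (C t : Measure Torus2) :=
          lintegral_mono_set hsub
      _ ≤ (∫⁻ t in Ioc a b, sqrtMass (C t : Measure Torus2)) +
          ∫⁻ t in Ioo b d, sqrtMass (C t : Measure Torus2) := lintegral_union_le _ _ _
      _ = (∫⁻ t in Ioo a b, sqrtMass (c t : Measure Torus2)) +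
          ∫⁻ t in Ioo b d, sqrtMass (c' t : Measure Torus2) := by
          rw [setLIntegral_congr Ioo_ae_eq_Ioc.symm]
          congr 1
          · refine setLIntegral_congr_fun measurableSet_Ioo fun t ht => ?_
            simp only [hl t ht.2.le]
          · refine setLIntegral_congr_fun measurableSet_Ioo fun t ht => ?_
            simp only [hr t ht.1.le]
      _ ≤ P + P' := add_le_add h.perimeter h'.perimeter
  · intro f hf s t has hst htd
    rcases le_total t b with htb | htb
    · rw [flowExcess_congr f hst fun r hr => hl r (hr.2.trans htb)]
      linarith [h.action f hf s t has hst htb]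
    rcases le_total b s with hbs | hbs
    · rw [flowExcess_congr f hst fun r hr' => hr r (hbs.trans hr'.1)]
      linarith [h'.action f hf s t hbs hst htd]
    rw [← flowExcess_add hcont hf s b t, flowExcess_congr f hbs fun r hr => hl r hr.2,
      flowExcess_congr f htb fun r hr' => hr r hr'.1]
    linarith [h.action f hf s b has hbs le_rfl, h'.action f hf b t le_rfl htb htd]

theorem IsFlow.mono {a b : ℝ} {c : ℝ → ProbabilityMeasure Torus2} {P P' : ℝ≥0∞} {A A' : ℝ}
    (h : IsFlow a b c P A) (hP : P ≤ P') (hA : A ≤ A') : IsFlow a b c P' A' :=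
  ⟨h.continuous, h.perimeter.trans hP, fun f hf s t h1 h2 h3 =>
    (h.action f hf s t h1 h2 h3).trans (by linarith)⟩

section Segment

variable {ι : Type*} [Fintype ι] [MeasurableSpace ι] [MeasurableSingletonClass ι]

/-- The law of the point `torusMk (X i)` when `i` has law `p`. -/
def pointLaw (p : ProbabilityMeasure ι) (X : ι → EuclideanSpace ℝ (Fin 2)) :
    ProbabilityMeasure Torus2 :=
  p.map (f := fun i => torusMk (X i)) (measurable_of_finite _).aemeasurable

theorem coe_pointLaw (p : ProbabilityMeasure ι) (X : ι → EuclideanSpace ℝ (Fin 2)) :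
    (pointLaw p X : Measure Torus2) = (p : Measure ι).map fun i => torusMk (X i) := rfl

theorem integral_pointLaw (p : ProbabilityMeasure ι) (X : ι → EuclideanSpace ℝ (Fin 2))
    {g : Torus2 → ℝ} (hg : Continuous g) :
    ∫ x, g x ∂(pointLaw p X : Measure Torus2) =
      ∑ i, (p : Measure ι).real {i} * g (torusMk (X i)) := by
  rw [coe_pointLaw, integral_map (measurable_of_finite _).aemeasurable
    hg.measurable.aestronglyMeasurable, integral_fintype (Integrable.of_finite)]
  simp

/-- Coinciding particles only lower the cost; the bound is then the Cauchy–Schwarz inequality. -/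
theorem sqrtMass_pointLaw_le (p : ProbabilityMeasure ι) (X : ι → EuclideanSpace ℝ (Fin 2)) :
    sqrtMass (pointLaw p X : Measure Torus2) ≤ ENNReal.ofReal √(Fintype.card ι) := by
  have hmeas : Measurable fun x : Torus2 =>
      ((pointLaw p X : Measure Torus2) {x}) ^ (-(1 / 2) : ℝ) := by
    have h1 : ∀ x : Torus2, (pointLaw p X : Measure Torus2) {x} =
        ∑ i, (p : Measure ι) {i} * ({torusMk (X i)} : Set Torus2).indicator 1 x := by
      intro x
      rw [coe_pointLaw, Measure.map_apply (measurable_of_finite _) (measurableSet_singleton x),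
        ← lintegral_indicator_one (measurable_of_finite (fun i => torusMk (X i))
          (measurableSet_singleton x)), lintegral_fintype]
      refine Finset.sum_congr rfl fun i _ => ?_
      rw [mul_comm]
      congr 1
      classical
      simp [indicator_apply, eq_comm (a := x)]
    simp_rw [h1]
    refine Measurable.pow_const (Finset.measurable_sum _ fun i _ => ?_) _
    exact (measurable_one.indicator (measurableSet_singleton _)).const_mul _
  have hle : sqrtMass (pointLaw p X : Measure Torus2) ≤
      ∑ i, ((p : Measure ι) {i}) ^ (1 / 2 : ℝ) := by
    have hmap : sqrtMass (pointLaw p X : Measure Torus2) =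
        ∫⁻ i, ((pointLaw p X : Measure Torus2) {torusMk (X i)}) ^ (-(1 / 2) : ℝ) ∂(p : Measure ι) :=
      lintegral_map hmeas (measurable_of_finite _)
    rw [hmap, lintegral_fintype]
    refine Finset.sum_le_sum fun i _ => ?_
    refine le_trans ?_ (rpow_neg_half_mul_self_le _ (measure_ne_top _ _))
    refine mul_le_mul_left (antitone_rpow_neg_half ?_) _
    rw [coe_pointLaw, Measure.map_apply (measurable_of_finite _) (measurableSet_singleton _)]
    exact measure_mono (by simp)
  refine hle.trans ?_
  have hsum : ∑ i, (p : Measure ι).real {i} = 1 := by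
    have h := integral_pointLaw p X (g := fun _ => 1) continuous_const
    simpa using h.symm
  have hconv : ∑ i, ((p : Measure ι) {i}) ^ (1 / 2 : ℝ) =
      ENNReal.ofReal (∑ i, √((p : Measure ι).real {i})) := by
    rw [ENNReal.ofReal_sum_of_nonneg fun i _ => Real.sqrt_nonneg _]
    refine Finset.sum_congr rfl fun i _ => ?_
    rw [Real.sqrt_eq_rpow, ← ENNReal.ofReal_rpow_of_nonneg measureReal_nonneg (by norm_num),
      ofReal_measureReal]
  rw [hconv]
  refine ENNReal.ofReal_le_ofReal (Real.le_sqrt_of_sq_le ?_)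
  have := sq_sum_le_card_mul_sum_sq (s := (Finset.univ : Finset ι))
    (f := fun i => √((p : Measure ι).real {i}))
  simp_rw [Real.sq_sqrt measureReal_nonneg] at this
  rwa [hsum, mul_one, Finset.card_univ] at this

/-- Finitely many particles moving with constant speed from `X i` to `Y i`. -/
theorem exists_segment_flow (p : ProbabilityMeasure ι) (X Y : ι → EuclideanSpace ℝ (Fin 2))
    {a b : ℝ} (hab : a < b) :
    ∃ c, IsFlow a b c (ENNReal.ofReal ((b - a) * √(Fintype.card ι)))
      ((∑ i, (p : Measure ι).real {i} * ‖Y i - X i‖ ^ 2) / (b - a)) ∧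
      c a = pointLaw p X ∧ c b = pointLaw p Y := by
  have hba : 0 < b - a := sub_pos.2 hab
  set V : ι → EuclideanSpace ℝ (Fin 2) := fun i => (b - a)⁻¹ • (Y i - X i) with hV
  set Z : ℝ → ι → EuclideanSpace ℝ (Fin 2) := fun t i => X i + (t - a) • V i with hZ
  have hZc : ∀ i, Continuous fun t => (t, torusMk (Z t i)) := fun i =>
    continuous_id.prodMk (continuous_torusMk.comp (by fun_prop))
  refine ⟨fun t => pointLaw p (Z t), ⟨?_, ?_, ?_⟩, ?_, ?_⟩
  · rw [ProbabilityMeasure.continuous_iff_forall_continuousMap_continuous_integral]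
    intro g
    simp_rw [integral_pointLaw p _ g.continuous]
    refine continuous_finsetSum _ fun i _ => continuous_const.mul ?_
    exact (g.continuous.comp continuous_snd).comp (hZc i)
  · calc ∫⁻ t in Ioo a b, sqrtMass (pointLaw p (Z t) : Measure Torus2)
        ≤ ∫⁻ _t in Ioo a b, ENNReal.ofReal √(Fintype.card ι) :=
          lintegral_mono fun t => sqrtMass_pointLaw_le p (Z t)
      _ = ENNReal.ofReal ((b - a) * √(Fintype.card ι)) := by
          rw [setLIntegral_const, Real.volume_Ioo, mul_comm, ENNReal.ofReal_mul hba.le]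
  · intro f hf s t has hst htb
    have hsl : ∀ {g : ℝ × Torus2 → ℝ}, Continuous g → ∀ r,
        ∫ x, g (r, x) ∂(pointLaw p (Z r) : Measure Torus2) =
          ∑ i, (p : Measure ι).real {i} * g (r, torusMk (Z r i)) := fun hg r =>
      integral_pointLaw p (Z r) (hg.comp (Continuous.prodMk_right r))
    have hcG : Continuous fun z => ‖horGrad f z‖ ^ 2 := hf.continuous_horGrad.norm.pow 2
    have hInt : ∀ {g : ℝ × Torus2 → ℝ}, Continuous g →
        ∫ r in s..t, ∫ x, g (r, x) ∂(pointLaw p (Z r) : Measure Torus2) =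
          ∑ i, (p : Measure ι).real {i} * ∫ r in s..t, g (r, torusMk (Z r i)) := by
      intro g hg
      simp_rw [hsl hg]
      rw [intervalIntegral.integral_finsetSum fun i _ => ?_]
      · simp_rw [intervalIntegral.integral_const_mul]
      · exact (continuous_const.mul (hg.comp (hZc i))).intervalIntegrable _ _
    rw [flowExcess, hsl hf.continuous, hsl hf.continuous, hInt hf.continuous_timeDeriv, hInt hcG,
      ← Finset.sum_sub_distrib, ← Finset.sum_sub_distrib, Finset.sum_div, Finset.sum_div,
      Finset.sum_div, ← Finset.sum_sub_distrib]
    refine Finset.sum_le_sum fun i _ => ?_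
    have hline : ∫ r in s..t, (timeDeriv f (r, torusMk (Z r i)) +
        inner ℝ (horGrad f (r, torusMk (Z r i))) (V i)) =
        f (t, torusMk (Z t i)) - f (s, torusMk (Z s i)) := by
      refine intervalIntegral.integral_eq_sub_of_hasDerivAt
        (fun r _ => hf.hasDerivAt_line (X i) (V i) a r) (Continuous.intervalIntegrable ?_ _ _)
      exact (hf.continuous_timeDeriv.comp (hZc i)).add
        ((hf.continuous_horGrad.comp (hZc i)).inner continuous_const)
    have hi1 : IntervalIntegrable (fun r => timeDeriv f (r, torusMk (Z r i))) volume s t :=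
      (hf.continuous_timeDeriv.comp (hZc i)).intervalIntegrable _ _
    have hi2 : IntervalIntegrable (fun r => inner ℝ (horGrad f (r, torusMk (Z r i))) (V i))
        volume s t :=
      ((hf.continuous_horGrad.comp (hZc i)).inner continuous_const).intervalIntegrable _ _
    have hi3 : IntervalIntegrable (fun r => ‖horGrad f (r, torusMk (Z r i))‖ ^ 2) volume s t :=
      (hcG.comp (hZc i)).intervalIntegrable _ _
    rw [intervalIntegral.integral_add hi1 hi2] at hline
    have hyoung : ∫ r in s..t, inner ℝ (horGrad f (r, torusMk (Z r i))) (V i) ≤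
        ∫ r in s..t, (‖horGrad f (r, torusMk (Z r i))‖ ^ 2 / 2 + ‖V i‖ ^ 2 / 2) := by
      refine intervalIntegral.integral_mono_on hst hi2 ((hi3.div_const 2).add
        intervalIntegrable_const) fun r _ => ?_
      have h1 := real_inner_le_norm (horGrad f (r, torusMk (Z r i))) (V i)
      nlinarith [sq_nonneg (‖horGrad f (r, torusMk (Z r i))‖ - ‖V i‖)]
    rw [intervalIntegral.integral_add (hi3.div_const 2) intervalIntegrable_const,
      intervalIntegral.integral_div, intervalIntegral.integral_const, smul_eq_mul] at hyoung
    have hVn : ‖V i‖ ^ 2 = ‖Y i - X i‖ ^ 2 / (b - a) ^ 2 := by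
      rw [hV, norm_smul, mul_pow, norm_inv, Real.norm_of_nonneg hba.le]
      field_simp
    have hVt : (t - s) * (‖V i‖ ^ 2 / 2) ≤ ‖Y i - X i‖ ^ 2 / (b - a) / 2 := by
      calc (t - s) * (‖V i‖ ^ 2 / 2) ≤ (b - a) * (‖V i‖ ^ 2 / 2) := by
            gcongr
        _ = ‖Y i - X i‖ ^ 2 / (b - a) / 2 := by
            rw [hVn]
            field_simp
    have hp : 0 ≤ (p : Measure ι).real {i} := measureReal_nonneg
    calc _ = (p : Measure ι).real {i} * ((∫ r in s..t, inner ℝ (horGrad f (r, torusMk (Z r i))) (V i)) -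
          (∫ r in s..t, ‖horGrad f (r, torusMk (Z r i))‖ ^ 2) / 2) := by
            rw [← mul_sub, ← hline]
            ring
      _ ≤ (p : Measure ι).real {i} * (‖Y i - X i‖ ^ 2 / (b - a) / 2) := by
            refine mul_le_mul_of_nonneg_left ?_ hp
            linarith
      _ = _ := by ring
  · simp [hZ]
  · refine congrArg (pointLaw p) (funext fun i => ?_)
    simp only [hZ, hV, smul_smul, mul_inv_cancel₀ hba.ne', one_smul]
    abel

end Segment

/-! ### Compactness of flows -/

/-- The real and imaginary parts of the Fourier monomials on the torus. -/
def trigMonomial (k : (Fin 2 → ℤ) × Bool) : C(Torus2, ℝ) where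
  toFun x := bif k.2 then (UnitAddTorus.mFourier k.1 x).re else (UnitAddTorus.mFourier k.1 x).im
  continuous_toFun := by
    cases k.2
    · exact Complex.continuous_im.comp (ContinuousMap.continuous _)
    · exact Complex.continuous_re.comp (ContinuousMap.continuous _)

theorem contDiff_mFourier (n : Fin 2 → ℤ) :
    ContDiff ℝ ∞ fun y : EuclideanSpace ℝ (Fin 2) => UnitAddTorus.mFourier n (torusMk y) := by
  have h : (fun y : EuclideanSpace ℝ (Fin 2) => UnitAddTorus.mFourier n (torusMk y)) =
      fun y => ∏ i, Complex.exp (2 * Real.pi * Complex.I * n i * (y i : ℂ) / (1 : ℝ)) := by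
    funext y
    simp only [UnitAddTorus.mFourier, ContinuousMap.coe_mk, torusMk]
    exact Finset.prod_congr rfl fun i _ => fourier_coe_apply
  rw [h]
  refine contDiff_prod fun i _ => ContDiff.cexp ?_
  refine ContDiff.div_const (contDiff_const.mul ?_) _
  exact Complex.ofRealCLM.contDiff.comp (EuclideanSpace.proj (𝕜 := ℝ) i).contDiff

theorem contDiff_trigMonomial (k : (Fin 2 → ℤ) × Bool) :
    ContDiff ℝ ∞ fun y : EuclideanSpace ℝ (Fin 2) => trigMonomial k (torusMk y) := by
  obtain ⟨n, b⟩ := k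
  cases b
  · exact Complex.imCLM.contDiff.comp (contDiff_mFourier n)
  · exact Complex.reCLM.contDiff.comp (contDiff_mFourier n)

/-- The Fourier coefficients of a probability measure on the torus. -/
def fourierEmb (ν : ProbabilityMeasure Torus2) (k : (Fin 2 → ℤ) × Bool) : ℝ :=
  ∫ x, trigMonomial k x ∂(ν : Measure Torus2)

theorem integrable_complex (ν : ProbabilityMeasure Torus2) (g : C(Torus2, ℂ)) :
    Integrable (⇑g) (ν : Measure Torus2) :=
  g.continuous.integrable_of_hasCompactSupport (HasCompactSupport.of_compactSpace g)

theorem continuous_integral_complex (ν : ProbabilityMeasure Torus2) :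
    Continuous fun g : C(Torus2, ℂ) => ∫ x, g x ∂(ν : Measure Torus2) := by
  refine LipschitzWith.continuous (K := 1) (LipschitzWith.of_dist_le_mul fun f g => ?_)
  rw [dist_eq_norm, ← integral_sub (integrable_complex ν f) (integrable_complex ν g), dist_eq_norm,
    NNReal.coe_one, one_mul]
  have := norm_integral_le_of_norm_le_const (μ := (ν : Measure Torus2)) (f := ⇑(f - g))
    (C := ‖f - g‖) (Eventually.of_forall fun y => (f - g).norm_coe_le_norm y)
  simpa using this

/-- Trigonometric polynomials are dense in `C(Q, ℂ)`. -/
theorem injective_fourierEmb : Function.Injective fourierEmb := by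
  intro ν ν' h
  have hF : ∀ n : Fin 2 → ℤ, ∫ x, UnitAddTorus.mFourier n x ∂(ν : Measure Torus2) =
      ∫ x, UnitAddTorus.mFourier n x ∂(ν' : Measure Torus2) := by
    intro n
    have h1 := congrFun h (n, true)
    have h2 := congrFun h (n, false)
    simp only [fourierEmb, trigMonomial, ContinuousMap.coe_mk, cond_true, cond_false] at h1 h2
    have e := fun ν : ProbabilityMeasure Torus2 =>
      integral_re_add_im (integrable_complex ν (UnitAddTorus.mFourier n))
    rw [← e ν, ← e ν']
    simp only [RCLike.re_to_complex, RCLike.im_to_complex]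
    rw [h1, h2]
  have hall : ∀ g : C(Torus2, ℂ), ∫ x, g x ∂(ν : Measure Torus2) =
      ∫ x, g x ∂(ν' : Measure Torus2) := by
    intro g
    have hcl : IsClosed {g : C(Torus2, ℂ) | ∫ x, g x ∂(ν : Measure Torus2) =
        ∫ x, g x ∂(ν' : Measure Torus2)} :=
      isClosed_eq (continuous_integral_complex ν) (continuous_integral_complex ν')
    have hspan : (Submodule.span ℂ (range (UnitAddTorus.mFourier (d := Fin 2))) :
        Set C(Torus2, ℂ)) ⊆ {g : C(Torus2, ℂ) | ∫ x, g x ∂(ν : Measure Torus2) =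
        ∫ x, g x ∂(ν' : Measure Torus2)} := by
      intro g hg
      refine Submodule.span_induction (p := fun g _ => ∫ x, g x ∂(ν : Measure Torus2) =
        ∫ x, g x ∂(ν' : Measure Torus2)) ?_ ?_ ?_ ?_ hg
      · rintro _ ⟨n, rfl⟩
        exact hF n
      · simp
      · intro f g _ _ hf hg
        simp only [ContinuousMap.add_apply]
        rw [integral_add (integrable_complex ν f) (integrable_complex ν g),
          integral_add (integrable_complex ν' f) (integrable_complex ν' g), hf, hg]
      · intro z f _ hf
        simp only [ContinuousMap.smul_apply, integral_smul, hf]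
    have hmem : g ∈ (Submodule.span ℂ (range (UnitAddTorus.mFourier (d := Fin 2)))).topologicalClosure := by
      rw [UnitAddTorus.span_mFourier_closure_eq_top]
      trivial
    exact closure_minimal hspan hcl hmem
  apply ProbabilityMeasure.toMeasure_injective
  refine ext_of_forall_integral_eq_of_IsFiniteMeasure fun g => ?_
  have := hall ⟨fun x => (g x : ℂ), Complex.continuous_ofReal.comp g.continuous⟩
  simp only [ContinuousMap.coe_mk] at this
  rw [integral_complex_ofReal, integral_complex_ofReal] at this
  exact_mod_cast this

/-- A continuous injection from a compact space, that of probability measures on the torus, to a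
Hausdorff space. -/
theorem isClosedEmbedding_fourierEmb : IsClosedEmbedding fourierEmb :=
  Continuous.isClosedEmbedding
    (continuous_pi fun k => ProbabilityMeasure.continuous_integral_continuousMap (trigMonomial k))
    injective_fourierEmb

/-- Bounded action makes a flow `1/2`-Hölder continuous against smooth functions. -/
theorem IsFlow.holder {a b : ℝ} {c : ℝ → ProbabilityMeasure Torus2} {P : ℝ≥0∞} {A B : ℝ}
    (h : IsFlow a b c P A) (hAB : A ≤ B) {u : Torus2 → ℝ}
    (hu : ContDiff ℝ ∞ fun y : EuclideanSpace ℝ (Fin 2) => u (torusMk y)) {K : ℝ}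
    (hK : ∀ z, ‖horGrad (fun z => u z.2) z‖ ^ 2 ≤ K) {s t : ℝ} (has : a ≤ s) (hst : s ≤ t)
    (htb : t ≤ b) :
    |∫ x, u x ∂(c t : Measure Torus2) - ∫ x, u x ∂(c s : Measure Torus2)| ≤
      (B + K) / 2 * √(t - s) := by
  rcases hst.eq_or_lt with rfl | hlt
  · simp
  have hts : 0 < t - s := sub_pos.2 hlt
  set q := √(t - s) with hq
  have hq0 : 0 < q := Real.sqrt_pos.2 hts
  have hqq : q ^ 2 = t - s := Real.sq_sqrt hts.le
  have hsm := SmoothOnTorus.of_space hu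
  have key : ∀ l : ℝ, l ^ 2 = 1 →
      l * (∫ x, u x ∂(c t : Measure Torus2) - ∫ x, u x ∂(c s : Measure Torus2)) ≤
        (B + K) / 2 * q := by
    intro l hl
    -- the test function is scaled by `1 / √(t - s)` to balance the two sides of Young's inequality
    have h1 := h.action ((l / q) • fun z => u z.2) (hsm.const_smul _) s t has hst htb
    rw [flowExcess] at h1
    simp only [timeDeriv_const_smul, horGrad_const_smul, timeDeriv_space, Pi.smul_apply,
      Pi.zero_apply, integral_zero, intervalIntegral.integral_zero, norm_smul, mul_pow,
      smul_eq_mul, integral_const_mul, intervalIntegral.integral_const_mul,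
      Real.norm_eq_abs, sq_abs] at h1
    have h2 : ∫ r in s..t, ∫ x, ‖horGrad (fun z => u z.2) (r, x)‖ ^ 2 ∂(c r : Measure Torus2) ≤
        ∫ _r in s..t, K := by
      refine intervalIntegral.integral_mono_on hst
        ((continuous_slice_horGrad_sq h.continuous hsm).intervalIntegrable _ _)
        intervalIntegrable_const fun r _ => ?_
      refine (integral_mono (integrable_of_continuous ?_ _) (integrable_const K)
        fun x => hK (r, x)).trans (by simp)
      exact (hsm.continuous_horGrad.comp (Continuous.prodMk_right r)).norm.pow 2
    rw [intervalIntegral.integral_const, smul_eq_mul, ← hqq] at h2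
    have h3 : (l / q) ^ 2 * (∫ r in s..t, ∫ x, ‖horGrad (fun z => u z.2) (r, x)‖ ^ 2
        ∂(c r : Measure Torus2)) ≤ K := by
      calc _ ≤ (l / q) ^ 2 * (q ^ 2 * K) := by gcongr
        _ = K := by
          rw [div_pow, hl]
          field_simp
    have h4 : l / q * (∫ x, u x ∂(c t : Measure Torus2) - ∫ x, u x ∂(c s : Measure Torus2)) ≤
        (B + K) / 2 := by linarith
    calc l * (∫ x, u x ∂(c t : Measure Torus2) - ∫ x, u x ∂(c s : Measure Torus2))
        = l / q * (∫ x, u x ∂(c t : Measure Torus2) - ∫ x, u x ∂(c s : Measure Torus2)) * q := by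
          field_simp
      _ ≤ (B + K) / 2 * q := by gcongr
  rw [abs_le]
  constructor
  · linarith [key (-1) (by norm_num)]
  · linarith [key 1 (by norm_num)]

theorem bounded_horGrad_space {u : Torus2 → ℝ}
    (hu : ContDiff ℝ ∞ fun y : EuclideanSpace ℝ (Fin 2) => u (torusMk y)) :
    ∃ K, ∀ z, ‖horGrad (fun z => u z.2) z‖ ^ 2 ≤ K := by
  have hc : Continuous fun x : Torus2 => ‖horGrad (fun z => u z.2) ((0 : ℝ), x)‖ ^ 2 :=
    ((SmoothOnTorus.of_space hu).continuous_horGrad.comp (Continuous.prodMk_right 0)).norm.pow 2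
  obtain ⟨K, hK⟩ := (isCompact_range hc).bddAbove
  exact ⟨K, fun z => hK ⟨z.2, rfl⟩⟩

theorem tendsto_interval_slice_integral {c : ℕ → ℝ → ProbabilityMeasure Torus2}
    {c₀ : ℝ → ProbabilityMeasure Torus2} (hc : ∀ n, Continuous (c n))
    (hlim : ∀ t, Tendsto (fun n => c n t) atTop (𝓝 (c₀ t))) {g : ℝ × Torus2 → ℝ}
    (hg : Continuous g) (s t : ℝ) :
    Tendsto (fun n => ∫ r in s..t, ∫ x, g (r, x) ∂(c n r : Measure Torus2)) atTop
      (𝓝 (∫ r in s..t, ∫ x, g (r, x) ∂(c₀ r : Measure Torus2))) := by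
  obtain ⟨K, hK⟩ := ((isCompact_uIcc (a := s) (b := t)).prod
    (isCompact_univ (X := Torus2))).exists_bound_of_continuousOn hg.continuousOn
  refine intervalIntegral.tendsto_integral_filter_of_dominated_convergence (fun _ => K) ?_ ?_
    intervalIntegrable_const ?_
  · exact Eventually.of_forall fun n => (continuous_slice_integral (hc n) hg).aestronglyMeasurable
  · refine Eventually.of_forall fun n => Eventually.of_forall fun r hr => ?_
    have := norm_integral_le_of_norm_le_const (μ := (c n r : Measure Torus2))
      (f := fun x => g (r, x)) (C := K)
      (Eventually.of_forall fun x => hK (r, x) ⟨uIoc_subset_uIcc hr, mem_univ _⟩)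
    simpa using this
  · refine Eventually.of_forall fun r _ => ?_
    let G : C(Torus2, ℝ) := ⟨fun x => g (r, x), hg.comp (Continuous.prodMk_right r)⟩
    exact ((ProbabilityMeasure.continuous_integral_continuousMap G).tendsto _).comp (hlim r)

theorem tendsto_slice_integral {c : ℕ → ℝ → ProbabilityMeasure Torus2}
    {c₀ : ℝ → ProbabilityMeasure Torus2}
    (hlim : ∀ t, Tendsto (fun n => c n t) atTop (𝓝 (c₀ t))) {g : ℝ × Torus2 → ℝ}
    (hg : Continuous g) (r : ℝ) :
    Tendsto (fun n => ∫ x, g (r, x) ∂(c n r : Measure Torus2)) atTop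
      (𝓝 (∫ x, g (r, x) ∂(c₀ r : Measure Torus2))) := by
  let G : C(Torus2, ℝ) := ⟨fun x => g (r, x), hg.comp (Continuous.prodMk_right r)⟩
  exact ((ProbabilityMeasure.continuous_integral_continuousMap G).tendsto _).comp (hlim r)

theorem tendsto_flowExcess {c : ℕ → ℝ → ProbabilityMeasure Torus2}
    {c₀ : ℝ → ProbabilityMeasure Torus2} (hc : ∀ n, Continuous (c n))
    (hlim : ∀ t, Tendsto (fun n => c n t) atTop (𝓝 (c₀ t))) {f : ℝ × Torus2 → ℝ}
    (hf : SmoothOnTorus f) (s t : ℝ) :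
    Tendsto (fun n => flowExcess f (c n) s t) atTop (𝓝 (flowExcess f c₀ s t)) :=
  (((tendsto_slice_integral hlim hf.continuous t).sub
    (tendsto_slice_integral hlim hf.continuous s)).sub
    (tendsto_interval_slice_integral hc hlim hf.continuous_timeDeriv s t)).sub
    ((tendsto_interval_slice_integral (g := fun z => ‖horGrad f z‖ ^ 2) hc hlim
      (hf.continuous_horGrad.norm.pow 2) s t).div_const 2)

/-- Sequential compactness of countable products. -/
theorem exists_subseq_tendsto_pi {κ Y : Type*} [Countable κ] [TopologicalSpace Y] [CompactSpace Y]
    [FirstCountableTopology Y] (x : ℕ → κ → Y) :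
    ∃ (d : κ → Y) (φ : ℕ → ℕ), StrictMono φ ∧ ∀ q, Tendsto (fun n => x (φ n) q) atTop (𝓝 (d q)) := by
  obtain ⟨d, -, φ, hφ, hd⟩ := (isCompact_univ (X := κ → Y)).tendsto_subseq (x := x)
    fun _ => mem_univ _
  exact ⟨d, φ, hφ, tendsto_pi_nhds.1 hd⟩

/-- Equi-Hölder curves of probability measures have a subsequence converging weakly at all times. -/
theorem exists_subseq_tendsto_curve {c : ℕ → ℝ → ProbabilityMeasure Torus2}
    {H : (Fin 2 → ℤ) × Bool → ℝ}
    (hH : ∀ n k s t, |fourierEmb (c n t) k - fourierEmb (c n s) k| ≤ H k * √|t - s|) :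
    ∃ (c₀ : ℝ → ProbabilityMeasure Torus2) (φ : ℕ → ℕ), StrictMono φ ∧ Continuous c₀ ∧
      ∀ t, Tendsto (fun n => c (φ n) t) atTop (𝓝 (c₀ t)) := by
  obtain ⟨d, φ, hφ, hd⟩ := exists_subseq_tendsto_pi fun n (q : ℚ) => c n (q : ℝ)
  have hcauchy : ∀ t k, CauchySeq fun n => fourierEmb (c (φ n) t) k := by
    intro t k
    rw [Metric.cauchySeq_iff']
    intro ε hε
    have hcont : Tendsto (fun r : ℝ => H k * √|t - r|) (𝓝 t) (𝓝 0) := by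
      have : Continuous fun r : ℝ => H k * √|t - r| := by fun_prop
      simpa using this.tendsto t
    obtain ⟨q, hq⟩ : ∃ q : ℚ, H k * √|t - q| < ε / 3 := by
      have hopen : IsOpen {r : ℝ | H k * √|t - r| < ε / 3} :=
        isOpen_lt (by fun_prop) continuous_const
      exact Rat.isDenseEmbedding_coe_real.dense.exists_mem_open hopen
        ⟨t, by simpa using hε⟩
    have hcq : CauchySeq fun n => fourierEmb (c (φ n) q) k :=
      ((((continuous_apply k).comp isClosedEmbedding_fourierEmb.continuous).tendsto _).comp
        (hd q)).cauchySeq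
    obtain ⟨N, hN⟩ := Metric.cauchySeq_iff'.1 hcq (ε / 3) (by positivity)
    refine ⟨N, fun n hn => ?_⟩
    have h1 := hH (φ n) k q t
    have h2 := hH (φ N) k q t
    have h3 := hN n hn
    rw [Real.dist_eq] at h3 ⊢
    rw [abs_le] at h1 h2
    rw [abs_lt] at h3 ⊢
    constructor <;> linarith
  choose ℓ hℓ using fun t k => cauchySeq_tendsto_of_complete (hcauchy t k)
  have hlim : ∀ t, Tendsto (fun n => fourierEmb (c (φ n) t)) atTop (𝓝 (ℓ t)) := fun t =>
    tendsto_pi_nhds.2 (hℓ t)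
  have hmem : ∀ t, ∃ ν, fourierEmb ν = ℓ t := fun t =>
    isClosedEmbedding_fourierEmb.isClosed_range.mem_of_tendsto (hlim t)
      (Eventually.of_forall fun n => mem_range_self _)
  choose c₀ hc₀ using hmem
  refine ⟨c₀, φ, hφ, ?_, fun t => ?_⟩
  · rw [isClosedEmbedding_fourierEmb.continuous_iff, continuous_pi_iff]
    intro k
    have hhol : ∀ s t, |ℓ t k - ℓ s k| ≤ H k * √|t - s| := fun s t =>
      le_of_tendsto ((hℓ t k).sub (hℓ s k)).abs (Eventually.of_forall fun n => hH (φ n) k s t)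
    rw [continuous_iff_continuousAt]
    intro s
    have hcont : Tendsto (fun t : ℝ => H k * √|t - s|) (𝓝 s) (𝓝 0) := by
      have : Continuous fun t : ℝ => H k * √|t - s| := by fun_prop
      simpa using this.tendsto s
    refine tendsto_iff_dist_tendsto_zero.2 (squeeze_zero (fun _ => dist_nonneg) (fun t => ?_) hcont)
    simp only [Function.comp, hc₀, Real.dist_eq]
    exact hhol s t
  · rw [isClosedEmbedding_fourierEmb.tendsto_nhds_iff, hc₀]
    exact hlim t

/-- Compactness of flows, with lower semicontinuity of both parts of the energy. -/
theorem exists_limit_flow {a b : ℝ} (hab : a ≤ b) {c : ℕ → ℝ → ProbabilityMeasure Torus2}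
    {P : ℕ → ℝ≥0∞} {A : ℕ → ℝ} (h : ∀ n, IsFlow a b (c n) (P n) (A n)) {P₀ : ℝ≥0∞} {A₀ : ℝ}
    (hP : Tendsto P atTop (𝓝 P₀)) (hA : Tendsto A atTop (𝓝 A₀)) {α β : ProbabilityMeasure Torus2}
    (hα : Tendsto (fun n => c n a) atTop (𝓝 α)) (hβ : Tendsto (fun n => c n b) atTop (𝓝 β)) :
    ∃ c₀, IsFlow a b c₀ P₀ A₀ ∧ c₀ a = α ∧ c₀ b = β := by
  set π : ℝ → ℝ := fun t => (projIcc a b hab t : ℝ) with hπ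
  have hπc : Continuous π := continuous_subtype_val.comp continuous_projIcc
  have hπm : ∀ t, π t ∈ Icc a b := fun t => (projIcc a b hab t).2
  have hπe : ∀ t ∈ Icc a b, π t = t := fun t ht => by rw [hπ]; simp [projIcc_of_mem hab ht]
  have hπl : ∀ s t, s ≤ t → π s ≤ π t ∧ π t - π s ≤ t - s := by
    intro s t hst
    simp only [hπ, coe_projIcc]
    constructor
    · gcongr
    · rcases le_total b s with h1 | h1 <;> rcases le_total b t with h2 | h2 <;>
      rcases le_total a s with h3 | h3 <;> rcases le_total a t with h4 | h4 <;>
      simp only [min_eq_left, min_eq_right, max_eq_left, max_eq_right, *] <;> linarith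
  set d : ℕ → ℝ → ProbabilityMeasure Torus2 := fun n t => c n (π t) with hd
  have hdc : ∀ n, Continuous (d n) := fun n => (h n).continuous.comp hπc
  obtain ⟨B, hB⟩ := hA.bddAbove_range
  choose K hK using fun k => bounded_horGrad_space (contDiff_trigMonomial k)
  have hhol : ∀ n k s t, |fourierEmb (d n t) k - fourierEmb (d n s) k| ≤
      (B + K k) / 2 * √|t - s| := by
    have main : ∀ n k s t, s ≤ t → |fourierEmb (d n t) k - fourierEmb (d n s) k| ≤
        (B + K k) / 2 * √|t - s| := by
      intro n k s t hst
      have h1 := (h n).holder (hB ⟨n, rfl⟩) (contDiff_trigMonomial k) (hK k) (hπm s).1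
        (hπl s t hst).1 (hπm t).2
      have hBK : 0 ≤ (B + K k) / 2 := by
        have h2 := (h n).action_nonneg hab
        have h3 : A n ≤ B := hB ⟨n, rfl⟩
        have h4 : (0 : ℝ) ≤ K k := le_trans (by positivity) (hK k (0, 0))
        linarith
      refine h1.trans (mul_le_mul_of_nonneg_left (Real.sqrt_le_sqrt ?_) hBK)
      exact (hπl s t hst).2.trans (le_abs_self _)
    intro n k s t
    rcases le_total s t with hst | hst
    · exact main n k s t hst
    · rw [abs_sub_comm, abs_sub_comm t s]
      exact main n k t s hst
  obtain ⟨c₀, φ, hφ, hc₀, hlim⟩ := exists_subseq_tendsto_curve hhol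
  refine ⟨c₀, ⟨hc₀, ?_, ?_⟩, ?_, ?_⟩
  · have hmeas : ∀ n, Measurable fun t => sqrtMass (d n t : Measure Torus2) := fun n =>
      (lowerSemicontinuous_sqrtMass.comp (hdc n)).measurable
    calc ∫⁻ t in Ioo a b, sqrtMass (c₀ t : Measure Torus2)
        ≤ ∫⁻ t in Ioo a b, liminf (fun n => sqrtMass (d (φ n) t : Measure Torus2)) atTop := by
          refine lintegral_mono fun t => ?_
          refine le_of_forall_lt_imp_le_of_dense fun y hy => ?_
          exact le_liminf_of_le (by isBoundedDefault)
            (((hlim t).eventually (lowerSemicontinuous_sqrtMass (c₀ t) y hy)).mono fun n => le_of_lt)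
      _ ≤ liminf (fun n => ∫⁻ t in Ioo a b, sqrtMass (d (φ n) t : Measure Torus2)) atTop :=
          lintegral_liminf_le fun n => hmeas (φ n)
      _ ≤ liminf (fun n => P (φ n)) atTop := by
          refine liminf_le_liminf (Eventually.of_forall fun n => ?_)
          refine le_trans (le_of_eq ?_) (h (φ n)).perimeter
          refine setLIntegral_congr_fun measurableSet_Ioo fun t ht => ?_
          simp only [hd, hπe t (Ioo_subset_Icc_self ht)]
      _ = P₀ := (hP.comp hφ.tendsto_atTop).liminf_eq
  · intro f hf s t has hst htb
    refine le_of_tendsto_of_tendsto (tendsto_flowExcess (fun n => hdc (φ n)) hlim hf s t)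
      ((hA.comp hφ.tendsto_atTop).div_const 2) (Eventually.of_forall fun n => ?_)
    have := (h (φ n)).action f hf s t has hst htb
    rwa [flowExcess_congr (c' := d (φ n)) f hst fun r hr => ?_] at this
    simp only [hd, hπe r ⟨has.trans hr.1, hr.2.trans htb⟩]
  · refine tendsto_nhds_unique (hlim a) ?_
    simp only [hd, hπe a ⟨le_rfl, hab⟩]
    exact hα.comp hφ.tendsto_atTop
  · refine tendsto_nhds_unique (hlim b) ?_
    simp only [hd, hπe b ⟨hab, le_rfl⟩]
    exact hβ.comp hφ.tendsto_atTop

/-! ### From flows to admissible pairs -/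

/-- The Riesz representation behind the dual form of the action: a functional `L` bounded by
`A / 2 + ‖G f‖² / 2` is the pairing of `G f` with a vector of squared norm at most `A`. -/
theorem exists_riesz_of_young {V H : Type*} [AddCommGroup V] [Module ℝ V] [NormedAddCommGroup H]
    [InnerProductSpace ℝ H] [CompleteSpace H] (G : V →ₗ[ℝ] H) (L : V →ₗ[ℝ] ℝ) {A : ℝ} (hA : 0 ≤ A)
    (h : ∀ f, L f ≤ A / 2 + ‖G f‖ ^ 2 / 2) :
    ∃ v : H, ‖v‖ ^ 2 ≤ A ∧ ∀ f, L f = inner ℝ (G f) v := by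
  have hscale : ∀ f (l : ℝ), l * L f ≤ A / 2 + l ^ 2 * ‖G f‖ ^ 2 / 2 := by
    intro f l
    have := h (l • f)
    rwa [map_smul, map_smul, norm_smul, mul_pow, smul_eq_mul, Real.norm_eq_abs, sq_abs] at this
  have hbound : ∀ f, |L f| ≤ √A * ‖G f‖ := by
    intro f
    -- the quadratic polynomial in `l` is nonnegative, so its discriminant is nonpositive
    have hd := discrim_le_zero (a := ‖G f‖ ^ 2 / 2) (b := -L f) (c := A / 2) fun l => by
      have := hscale f l
      nlinarith
    rw [discrim] at hd
    rw [← Real.sqrt_sq (norm_nonneg (G f)), ← Real.sqrt_mul hA, ← Real.sqrt_sq_eq_abs]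
    exact Real.sqrt_le_sqrt (by nlinarith)
  have hker : LinearMap.ker G ≤ LinearMap.ker L := by
    intro f hf
    rw [LinearMap.mem_ker] at hf ⊢
    have := hbound f
    rw [hf, norm_zero, mul_zero] at this
    exact abs_nonpos_iff.1 this
  let ℓ : LinearMap.range G →ₗ[ℝ] ℝ :=
    ((LinearMap.ker G).liftQ L hker).comp G.quotKerEquivRange.symm.toLinearMap
  have hℓ : ∀ f, ℓ ⟨G f, LinearMap.mem_range_self G f⟩ = L f := by
    intro f
    have h1 : G.quotKerEquivRange.symm ⟨G f, LinearMap.mem_range_self G f⟩ =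
        (LinearMap.ker G).mkQ f := by
      rw [LinearEquiv.symm_apply_eq]
      exact Subtype.ext (G.quotKerEquivRange_apply_mk f).symm
    change (LinearMap.ker G).liftQ L hker (G.quotKerEquivRange.symm ⟨G f, _⟩) = L f
    rw [h1]
    exact Submodule.liftQ_apply _ _ _
  have hℓb : ∀ x : LinearMap.range G, ‖ℓ x‖ ≤ √A * ‖x‖ := by
    rintro ⟨_, f, rfl⟩
    rw [hℓ]
    exact hbound f
  obtain ⟨g, hg, hgn⟩ := exists_extension_norm_eq (𝕜 := ℝ) (LinearMap.range G) (ℓ.mkContinuous √A hℓb)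
  refine ⟨(InnerProductSpace.toDual ℝ H).symm g, ?_, fun f => ?_⟩
  · rw [LinearIsometryEquiv.norm_map, hgn]
    calc _ ≤ √A ^ 2 := by
          gcongr
          exact LinearMap.mkContinuous_norm_le _ (Real.sqrt_nonneg A) _
      _ = A := Real.sq_sqrt hA
  · rw [real_inner_comm, InnerProductSpace.toDual_symm_apply]
    have := hg ⟨G f, LinearMap.mem_range_self G f⟩
    rw [LinearMap.mkContinuous_apply, hℓ] at this
    exact this.symm

instance (T : ℝ) (κ : Kernel ℝ Torus2) [IsFiniteKernel κ] : IsFiniteMeasure (spaceTime T κ) := by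
  unfold spaceTime
  infer_instance

theorem memLp_spaceTime {E : Type*} [NormedAddCommGroup E] [SecondCountableTopology E]
    (T : ℝ) (κ : Kernel ℝ Torus2) [IsFiniteKernel κ] {g : ℝ × Torus2 → E} (hg : Continuous g)
    (p : ℝ≥0∞) : MemLp g p (spaceTime T κ) := by
  borelize E
  obtain ⟨K, hK⟩ := ((isCompact_Icc (a := -T) (b := T)).prod
    (isCompact_univ (X := Torus2))).exists_bound_of_continuousOn hg.continuousOn
  refine MemLp.of_bound hg.measurable.aestronglyMeasurable K ?_
  have h1 : ∀ᵐ t ∂(volume.restrict (Ioo (-T) T)), t ∈ Ioo (-T) T :=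
    ae_restrict_mem measurableSet_Ioo
  filter_upwards [Measure.ae_compProd_of_ae_fst κ measurableSet_Ioo h1] with z hz
  exact hK z ⟨Ioo_subset_Icc_self hz, mem_univ _⟩

theorem integral_spaceTime (T : ℝ) (κ : Kernel ℝ Torus2) [IsFiniteKernel κ] {g : ℝ × Torus2 → ℝ}
    (hg : Continuous g) :
    ∫ z, g z ∂(spaceTime T κ) = ∫ t in Ioo (-T) T, ∫ x, g (t, x) ∂(κ t) :=
  Measure.integral_compProd ((memLp_spaceTime T κ hg 1).integrable le_rfl)

theorem IsTestFunction.smoothOnTorus {T : ℝ} {f : ℝ × Torus2 → ℝ} (hf : IsTestFunction T f) :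
    SmoothOnTorus f := hf.smooth

/-- The vector space of test functions on `(-T, T) × Q`. -/
def testFunctions (T : ℝ) : Submodule ℝ (ℝ × Torus2 → ℝ) where
  carrier := {f | IsTestFunction T f}
  add_mem' {f g} hf hg :=
    ⟨hf.smoothOnTorus.add hg.smoothOnTorus, hf.compact.add hg.compact,
      (tsupport_add f g).trans (union_subset hf.support hg.support)⟩
  zero_mem' := ⟨contDiff_const, HasCompactSupport.zero, by simp [tsupport]⟩
  smul_mem' c f hf :=
    ⟨hf.smoothOnTorus.const_smul c, hf.compact.smul_left (f := fun _ => c),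
      (tsupport_smul_subset_right (fun _ => c) f).trans hf.support⟩

/-- The gradient as a linear map from test functions to `L²(μ; ℝ²)`. -/
def gradLp (T : ℝ) (κ : Kernel ℝ Torus2) [IsFiniteKernel κ] :
    testFunctions T →ₗ[ℝ] Lp (EuclideanSpace ℝ (Fin 2)) 2 (spaceTime T κ) where
  toFun f := (memLp_spaceTime T κ (IsTestFunction.smoothOnTorus f.2).continuous_horGrad 2).toLp _
  map_add' f g := by
    rw [← MemLp.toLp_add]
    congr 1
    exact SmoothOnTorus.horGrad_add (IsTestFunction.smoothOnTorus f.2)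
      (IsTestFunction.smoothOnTorus g.2)
  map_smul' c f := by
    rw [RingHom.id_apply, ← MemLp.toLp_const_smul]
    congr 1
    exact horGrad_const_smul c f

/-- The functional `f ↦ -∫ ∂_t f dμ`. -/
def negTimeDeriv (T : ℝ) (κ : Kernel ℝ Torus2) [IsFiniteKernel κ] : testFunctions T →ₗ[ℝ] ℝ where
  toFun f := -∫ z, timeDeriv f z ∂(spaceTime T κ)
  map_add' f g := by
    have h := fun f : testFunctions T => (memLp_spaceTime T κ
      (IsTestFunction.smoothOnTorus f.2).continuous_timeDeriv 1).integrable le_rfl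
    rw [Submodule.coe_add, SmoothOnTorus.timeDeriv_add (IsTestFunction.smoothOnTorus f.2)
      (IsTestFunction.smoothOnTorus g.2)]
    simp only [Pi.add_apply]
    rw [integral_add (h f) (h g)]
    ring
  map_smul' c f := by
    rw [Submodule.coe_smul, timeDeriv_const_smul]
    simp only [Pi.smul_apply, smul_eq_mul, RingHom.id_apply]
    rw [integral_const_mul]
    ring

/-- The flux with density `v` has Radon–Nikodym density `v`. -/
theorem fluxDensity_withDensity {μ : Measure (ℝ × Torus2)} [IsFiniteMeasure μ]
    {v : ℝ × Torus2 → EuclideanSpace ℝ (Fin 2)} (hv : Integrable v μ) :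
    fluxDensity (μ.withDensityᵥ v) μ =ᵐ[μ] v := by
  have hcoord : ∀ i, (fun z => v z i) =ᵐ[μ] SignedMeasure.rnDeriv
      ((μ.withDensityᵥ v).mapRange (coordHom i) (continuous_coordHom i)) μ := by
    intro i
    have hvi : Integrable (fun z => v z i) μ := (EuclideanSpace.proj (𝕜 := ℝ) i).integrable_comp hv
    refine SignedMeasure.eq_rnDeriv 0 (fun z => v z i) hvi VectorMeasure.MutuallySingular.zero_left ?_
    rw [zero_add]
    ext s hs
    rw [VectorMeasure.mapRange_apply, withDensityᵥ_apply hv hs, withDensityᵥ_apply hvi hs]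
    exact ((EuclideanSpace.proj (𝕜 := ℝ) i : EuclideanSpace ℝ (Fin 2) →L[ℝ] ℝ).integral_comp_comm
      hv.integrableOn).symm
  filter_upwards [hcoord 0, hcoord 1] with z h0 h1
  ext i
  fin_cases i
  · exact h0.symm
  · exact h1.symm

/-- A weakly continuous curve of probability measures is measurable, since its values on open sets are
lower semicontinuous. -/
theorem measurable_curve {c : ℝ → ProbabilityMeasure Torus2} (hc : Continuous c) :
    Measurable fun t => (c t : Measure Torus2) := by
  refine Measurable.measure_of_isPiSystem_of_isProbabilityMeasure
    (BorelSpace.measurable_eq (α := Torus2)) isPiSystem_isOpen fun U hU => ?_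
  have hlsc : LowerSemicontinuous fun t => (c t : Measure Torus2) U :=
    lowerSemicontinuous_iff_le_liminf.2 fun t =>
      ProbabilityMeasure.le_liminf_measure_open_of_tendsto (hc.tendsto t) hU
  exact hlsc.measurable

/-- A flow comes with an admissible pair: the flux is obtained from the dual form of the action by
the Riesz representation theorem in `L²(μ; ℝ²)`. -/
theorem IsFlow.exists_admissible {T : ℝ} (hT : 0 < T) {c : ℝ → ProbabilityMeasure Torus2}
    {P : ℝ≥0∞} {A : ℝ} (h : IsFlow (-T) T c P A) (hP : P ≠ ⊤) :
    ∃ (κ : Kernel ℝ Torus2) (m : VectorMeasure (ℝ × Torus2) (EuclideanSpace ℝ (Fin 2))),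
      IsAdmissible T κ m ∧ HasTraces T κ (c (-T)) (c T) ∧
      pairEnergy T κ m ≤ P + ENNReal.ofReal A := by
  have hTT : -T ≤ T := by linarith
  let κ : Kernel ℝ Torus2 := ⟨fun t => (c t : Measure Torus2), measurable_curve h.continuous⟩
  have hκ : ∀ t, κ t = (c t : Measure Torus2) := fun t => rfl
  have : IsMarkovKernel κ := ⟨fun t => by rw [hκ]; infer_instance⟩
  set μ := spaceTime T κ with hμ
  have : IsFiniteMeasure μ := by
    rw [hμ]
    infer_instance
  have hint : ∀ {g : ℝ × Torus2 → ℝ}, Continuous g →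
      ∫ z, g z ∂μ = ∫ t in (-T)..T, ∫ x, g (t, x) ∂(c t : Measure Torus2) := by
    intro g hg
    rw [hμ, integral_spaceTime T κ hg, intervalIntegral.integral_of_le hTT,
      integral_Ioc_eq_integral_Ioo]
    rfl
  have hnorm : ∀ v : Lp (EuclideanSpace ℝ (Fin 2)) 2 μ, ‖v‖ ^ 2 = ∫ z, ‖v z‖ ^ 2 ∂μ := by
    intro v
    rw [← real_inner_self_eq_norm_sq, L2.inner_def]
    simp_rw [real_inner_self_eq_norm_sq]
  obtain ⟨v, hvA, hv⟩ := exists_riesz_of_young (gradLp T κ) (negTimeDeriv T κ)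
    (h.action_nonneg hTT) (by
      intro f
      have hf := IsTestFunction.smoothOnTorus f.2
      have h0 : ∀ t, t ∉ Ioo (-T) T → ∀ x, (f : ℝ × Torus2 → ℝ) (t, x) = 0 := fun t ht x =>
        image_eq_zero_of_notMem_tsupport fun hm => ht (f.2.support hm).1
      have h1 := h.action f hf (-T) T le_rfl hTT le_rfl
      rw [flowExcess] at h1
      simp only [h0 T (by simp), h0 (-T) (by simp), integral_zero] at h1
      have h2 : ‖gradLp T κ f‖ ^ 2 = ∫ z, ‖horGrad f z‖ ^ 2 ∂μ := by
        rw [hnorm]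
        refine integral_congr_ae ?_
        filter_upwards [MemLp.coeFn_toLp (memLp_spaceTime T κ hf.continuous_horGrad 2)] with z hz
        exact congrArg (‖·‖ ^ 2) hz
      have h3 : negTimeDeriv T κ f = -∫ z, timeDeriv f z ∂μ := rfl
      rw [h2, h3, hint hf.continuous_timeDeriv,
        hint (g := fun z => ‖horGrad f z‖ ^ 2) (hf.continuous_horGrad.norm.pow 2)]
      linarith)
  have hvi : Integrable v μ := (Lp.memLp v).integrable (by norm_num)
  have hflux : fluxDensity (μ.withDensityᵥ v) μ =ᵐ[μ] v := fluxDensity_withDensity hvi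
  have hlsc : Measurable fun t => sqrtMass (c t : Measure Torus2) :=
    (lowerSemicontinuous_sqrtMass.comp h.continuous).measurable
  have hfin : ∀ᵐ t ∂(volume.restrict (Ioo (-T) T)), sqrtMass (c t : Measure Torus2) < ⊤ :=
    ae_lt_top hlsc (ne_top_of_le_ne_top hP h.perimeter)
  refine ⟨κ, μ.withDensityᵥ v, ⟨inferInstance, ?_, ?_, ?_⟩, ?_, ?_⟩
  · filter_upwards [hfin] with t ht
    rw [hκ]
    exact (discrete_of_sqrtMass_ne_top ht.ne).1
  · refine VectorMeasure.AbsolutelyContinuous.mk fun s hs h0 => ?_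
    rw [Measure.toENNRealVectorMeasure_apply_measurable hs] at h0
    rw [withDensityᵥ_apply hvi hs, Measure.restrict_eq_zero.2 h0, integral_zero_measure]
  · intro f hf
    have h1 := hv ⟨f, hf⟩
    have h2 : negTimeDeriv T κ ⟨f, hf⟩ = -∫ z, timeDeriv f z ∂μ := rfl
    have h3 : inner ℝ (gradLp T κ ⟨f, hf⟩) v =
        ∫ z, inner ℝ (horGrad f z) (fluxDensity (μ.withDensityᵥ v) μ z) ∂μ := by
      rw [L2.inner_def]
      refine integral_congr_ae ?_
      filter_upwards [MemLp.coeFn_toLp (memLp_spaceTime T κ hf.smoothOnTorus.continuous_horGrad 2),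
        hflux] with z hz hz'
      rw [hz']
      exact congrArg (inner ℝ · (v z)) hz
    rw [← h3, ← h1, h2]
    ring
  · refine ⟨fun t => (c t).toFiniteMeasure, ?_, ?_, rfl, rfl⟩
    · exact (ProbabilityMeasure.toFiniteMeasure_continuous.comp h.continuous).continuousOn
    · exact Eventually.of_forall fun t => rfl
  · refine add_le_add (le_trans (lintegral_mono_ae ?_) h.perimeter) ?_
    · filter_upwards [hfin] with t ht
      rw [hκ]
      exact (discrete_of_sqrtMass_ne_top ht.ne).2
    · calc ∫⁻ z, ‖fluxDensity (μ.withDensityᵥ v) μ z‖ₑ ^ 2 ∂μ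
          = ∫⁻ z, ENNReal.ofReal (‖v z‖ ^ 2) ∂μ := by
            refine lintegral_congr_ae ?_
            filter_upwards [hflux] with z hz
            rw [hz, ENNReal.ofReal_pow (norm_nonneg _), ofReal_norm]
        _ = ENNReal.ofReal (‖v‖ ^ 2) := by
            rw [hnorm, ofReal_integral_eq_lintegral_ofReal]
            · exact (memLp_two_iff_integrable_sq_norm (Lp.memLp v).1).1 (Lp.memLp v)
            · exact Eventually.of_forall fun z => by positivity
        _ ≤ ENNReal.ofReal A := ENNReal.ofReal_le_ofReal hvA

/-! ### From admissible pairs to flows -/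

/-- A monotone transition `τ` from `0` to `1` has a derivative of integral one, so that averaging against
it stays close to values on the transition region. -/
theorem abs_integral_deriv_mul_sub_le {τ k : ℝ → ℝ} (hτ : ContDiff ℝ ∞ τ) (hmono : Monotone τ)
    (hk : Continuous k) {s t y ε : ℝ} (hst : s ≤ t) (h0 : τ s = 0) (h1 : τ t = 1)
    (hε : ∀ r ∈ Icc s t, deriv τ r ≠ 0 → |k r - y| ≤ ε) :
    |(∫ r in s..t, deriv τ r * k r) - y| ≤ ε := by
  have hdc : Continuous (deriv τ) := hτ.continuous_deriv (by simp)
  have hone : ∫ r in s..t, deriv τ r = 1 := by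
    rw [intervalIntegral.integral_deriv_eq_sub (fun r _ => hτ.differentiable (by simp) r)
      (hdc.intervalIntegrable _ _), h0, h1, sub_zero]
  have hsub : (∫ r in s..t, deriv τ r * k r) - y = ∫ r in s..t, deriv τ r * (k r - y) := by
    simp_rw [mul_sub]
    rw [intervalIntegral.integral_sub ((hdc.fun_mul hk).intervalIntegrable _ _)
      ((hdc.fun_mul continuous_const).intervalIntegrable _ _), intervalIntegral.integral_mul_const,
      hone, one_mul]
  have hnn : ∀ r, 0 ≤ deriv τ r := fun r => hmono.deriv_nonneg
  calc |(∫ r in s..t, deriv τ r * k r) - y| = |∫ r in s..t, deriv τ r * (k r - y)| := by rw [hsub]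
    _ ≤ ∫ r in s..t, |deriv τ r * (k r - y)| := intervalIntegral.abs_integral_le_integral_abs hst
    _ ≤ ∫ r in s..t, deriv τ r * ε := by
        refine intervalIntegral.integral_mono_on hst
          (Continuous.intervalIntegrable (by fun_prop) _ _)
          (Continuous.intervalIntegrable (by fun_prop) _ _) fun r hr => ?_
        rw [abs_mul, abs_of_nonneg (hnn r)]
        rcases eq_or_ne (deriv τ r) 0 with hz | hz
        · simp [hz]
        · exact mul_le_mul_of_nonneg_left (hε r hr hz) (hnn r)
    _ = ε := by rw [intervalIntegral.integral_mul_const, hone, one_mul]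

theorem deriv_eq_zero_of_const_nhds {τ : ℝ → ℝ} {r y : ℝ} (h : ∀ᶠ x in 𝓝 r, τ x = y) :
    deriv τ r = 0 := by
  rw [(show τ =ᶠ[𝓝 r] fun _ => y from h).deriv_eq, deriv_const]

/-- An inequality tested against smooth cutoffs of `(s, t)` passes to the indicator function of
`(s, t)`, producing boundary values. -/
theorem sub_le_of_forall_cutoff {h g : ℝ → ℝ} (hh : Continuous h) (hg : Continuous g) {s t R : ℝ}
    (hst : s < t)
    (H : ∀ ψ : ℝ → ℝ, ContDiff ℝ ∞ ψ → (∀ r, 0 ≤ ψ r ∧ ψ r ≤ 1) → tsupport ψ ⊆ Ioo s t →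
      -(∫ r in s..t, deriv ψ r * h r) - ∫ r in s..t, ψ r * g r ≤ R) :
    h t - h s - ∫ r in s..t, g r ≤ R := by
  -- subtracting a primitive of `g` reduces the claim to `g = 0`
  set k : ℝ → ℝ := fun r => h r - ∫ x in s..r, g x with hkdef
  have hG : ∀ r, HasDerivAt (fun r => ∫ x in s..r, g x) (g r) r := fun r =>
    intervalIntegral.integral_hasDerivAt_right (hg.intervalIntegrable _ _)
      hg.stronglyMeasurable.stronglyMeasurableAtFilter hg.continuousAt
  have hGc : Continuous fun r => ∫ x in s..r, g x :=
    continuous_iff_continuousAt.2 fun r => (hG r).continuousAt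
  have hk : Continuous k := hh.sub hGc
  have Hk : ∀ ψ : ℝ → ℝ, ContDiff ℝ ∞ ψ → (∀ r, 0 ≤ ψ r ∧ ψ r ≤ 1) → tsupport ψ ⊆ Ioo s t →
      -(∫ r in s..t, deriv ψ r * k r) ≤ R := by
    intro ψ hψ h01 hsupp
    have hdc : Continuous (deriv ψ) := hψ.continuous_deriv (by simp)
    have hz : ∀ r, r ∉ Ioo s t → ψ r = 0 := fun r hr =>
      image_eq_zero_of_notMem_tsupport fun hm => hr (hsupp hm)
    have hibp := intervalIntegral.integral_deriv_mul_eq_sub (a := s) (b := t)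
      (fun r _ => (hψ.differentiable (by simp) r).hasDerivAt) (fun r _ => hG r)
      (hdc.intervalIntegrable _ _) (hg.intervalIntegrable _ _)
    rw [hz s (by simp), hz t (by simp), zero_mul, zero_mul, sub_zero,
      intervalIntegral.integral_add ((hdc.fun_mul hGc).intervalIntegrable _ _)
      ((hψ.continuous.fun_mul hg).intervalIntegrable _ _)] at hibp
    have hsplit : ∫ r in s..t, deriv ψ r * k r =
        (∫ r in s..t, deriv ψ r * h r) - ∫ r in s..t, deriv ψ r * ∫ x in s..r, g x := by
      rw [← intervalIntegral.integral_sub ((hdc.fun_mul hh).intervalIntegrable _ _)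
        ((hdc.fun_mul hGc).intervalIntegrable _ _)]
      simp_rw [hkdef, mul_sub]
    have := H ψ hψ h01 hsupp
    linarith
  have hgoal : h t - h s - ∫ r in s..t, g r = k t - k s := by
    simp only [hkdef, intervalIntegral.integral_same]
    ring
  rw [hgoal]
  refine le_of_forall_pos_le_add fun ε hε => ?_
  obtain ⟨δ₁, hδ₁, hs⟩ := Metric.continuousAt_iff.1 (hk.continuousAt (x := s)) (ε / 2) (half_pos hε)
  obtain ⟨δ₂, hδ₂, ht⟩ := Metric.continuousAt_iff.1 (hk.continuousAt (x := t)) (ε / 2) (half_pos hε)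
  obtain ⟨δ, hδ, hd1, hd2, hd3⟩ : ∃ δ > 0, 2 * δ < δ₁ ∧ 2 * δ < δ₂ ∧ 4 * δ ≤ t - s := by
    refine ⟨min (min (δ₁ / 4) (δ₂ / 4)) ((t - s) / 4), ?_, ?_, ?_, ?_⟩
    · have : 0 < t - s := sub_pos.2 hst
      positivity
    · have := (min_le_left (min (δ₁ / 4) (δ₂ / 4)) ((t - s) / 4)).trans (min_le_left _ _)
      linarith
    · have := (min_le_left (min (δ₁ / 4) (δ₂ / 4)) ((t - s) / 4)).trans (min_le_right _ _)
      linarith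
    · have := min_le_right (min (δ₁ / 4) (δ₂ / 4)) ((t - s) / 4)
      linarith
  -- `τ y` rises from `0` to `1` on `[y, y + δ]`
  set τ : ℝ → ℝ → ℝ := fun y r => Real.smoothTransition ((r - y) / δ) with hτ
  have hτs : ∀ y, ContDiff ℝ ∞ (τ y) := fun y =>
    Real.smoothTransition.contDiff.comp ((contDiff_id.sub contDiff_const).div_const δ)
  have hτm : ∀ y, Monotone (τ y) := fun y r r' hr =>
    Real.smoothTransition.monotone (by gcongr)
  have hτ0 : ∀ y r, r ≤ y → τ y r = 0 := fun y r hr =>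
    Real.smoothTransition.zero_of_nonpos (div_nonpos_of_nonpos_of_nonneg (by linarith) hδ.le)
  have hτ1 : ∀ y r, y + δ ≤ r → τ y r = 1 := fun y r hr =>
    Real.smoothTransition.one_of_one_le ((one_le_div hδ).2 (by linarith))
  have hτd : ∀ y r, deriv (τ y) r ≠ 0 → y ≤ r ∧ r ≤ y + δ := by
    intro y r hr
    by_contra hcon
    rw [not_and_or, not_le, not_le] at hcon
    apply hr
    rcases hcon with h1 | h1
    · exact deriv_eq_zero_of_const_nhds ((eventually_lt_nhds h1).mono fun x hx => hτ0 y x hx.le)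
    · exact deriv_eq_zero_of_const_nhds ((eventually_gt_nhds h1).mono fun x hx => hτ1 y x hx.le)
  have e1 := abs_integral_deriv_mul_sub_le (y := k s) (ε := ε / 2) (hτs (s + δ)) (hτm _) hk hst.le
    (hτ0 _ _ (by linarith)) (hτ1 _ _ (by linarith)) fun r _ hne => by
      have := hτd _ _ hne
      refine (hs ?_).le
      rw [Real.dist_eq, abs_lt]
      constructor <;> linarith
  have e2 := abs_integral_deriv_mul_sub_le (y := k t) (ε := ε / 2) (hτs (t - 2 * δ)) (hτm _) hk
    hst.le (hτ0 _ _ (by linarith)) (hτ1 _ _ (by linarith)) fun r _ hne => by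
      have := hτd _ _ hne
      refine (ht ?_).le
      rw [Real.dist_eq, abs_lt]
      constructor <;> linarith
  -- this cutoff is supported in `[s + δ, t - δ]`, rises just after `s` and falls just before `t`
  have hψ := Hk (fun r => τ (s + δ) r - τ (t - 2 * δ) r) ((hτs _).sub (hτs _)) (fun r => ?_) ?_
  · have hder : ∀ r, deriv (fun r => τ (s + δ) r - τ (t - 2 * δ) r) r =
        deriv (τ (s + δ)) r - deriv (τ (t - 2 * δ)) r := fun r =>
      deriv_fun_sub ((hτs _).differentiable (by simp) r) ((hτs _).differentiable (by simp) r)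
    simp_rw [hder, sub_mul] at hψ
    have hc : ∀ y, Continuous (deriv (τ y)) := fun y => (hτs y).continuous_deriv (by simp)
    rw [intervalIntegral.integral_sub (((hc _).fun_mul hk).intervalIntegrable _ _)
      (((hc _).fun_mul hk).intervalIntegrable _ _)] at hψ
    rw [abs_le] at e1 e2
    linarith [e1.1, e1.2, e2.1, e2.2]
  · rcases le_total r (t - 2 * δ) with hr | hr
    · rw [hτ0 (t - 2 * δ) r hr, sub_zero]
      exact ⟨Real.smoothTransition.nonneg _, Real.smoothTransition.le_one _⟩
    · rw [hτ1 (s + δ) r (by linarith)]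
      exact ⟨sub_nonneg.2 (Real.smoothTransition.le_one _),
        sub_le_self _ (Real.smoothTransition.nonneg _)⟩
  · have hsub : tsupport (fun r => τ (s + δ) r - τ (t - 2 * δ) r) ⊆ Icc (s + δ) (t - δ) := by
      refine closure_minimal (fun r hr => ?_) isClosed_Icc
      by_contra hcon
      rw [mem_Icc, not_and_or, not_le, not_le] at hcon
      apply hr
      rcases hcon with h1 | h1
      · simp only [hτ0 (s + δ) r h1.le, hτ0 (t - 2 * δ) r (by linarith), sub_zero]
      · simp only [hτ1 (s + δ) r (by linarith), hτ1 (t - 2 * δ) r (by linarith), sub_self]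
    exact hsub.trans (Icc_subset_Ioo (by linarith) (by linarith))

theorem isTestFunction_mul_time {T : ℝ} {ψ : ℝ → ℝ} (hψ : ContDiff ℝ ∞ ψ)
    (hsupp : tsupport ψ ⊆ Ioo (-T) T) {f : ℝ × Torus2 → ℝ} (hf : SmoothOnTorus f) :
    IsTestFunction T fun z => ψ z.1 * f z := by
  have hcomp : IsCompact (tsupport ψ) :=
    isCompact_Icc.of_isClosed_subset (isClosed_tsupport ψ) (hsupp.trans Ioo_subset_Icc_self)
  have hsub : tsupport (fun z : ℝ × Torus2 => ψ z.1 * f z) ⊆ tsupport ψ ×ˢ univ := by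
    refine closure_minimal (fun z hz => ⟨subset_tsupport ψ fun h0 => hz ?_, mem_univ _⟩)
      ((isClosed_tsupport ψ).prod isClosed_univ)
    simp only [h0, zero_mul]
  exact ⟨hf.mul_time hψ, (hcomp.prod isCompact_univ).of_isClosed_subset (isClosed_tsupport _) hsub,
    hsub.trans (prod_mono hsupp subset_rfl)⟩

theorem measurable_fluxDensity (m : VectorMeasure (ℝ × Torus2) (EuclideanSpace ℝ (Fin 2)))
    (μ : Measure (ℝ × Torus2)) : Measurable (fluxDensity m μ) :=
  (MeasurableEquiv.toLp 2 (Fin 2 → ℝ)).measurable.comp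
    (measurable_pi_lambda _ fun _ => SignedMeasure.measurable_rnDeriv _ _)

/-- The continuity equation implies the dual bound on the action by Young's inequality. -/
theorem IsAdmissible.neg_integral_timeDeriv_le {T : ℝ} {κ : Kernel ℝ Torus2}
    {m : VectorMeasure (ℝ × Torus2) (EuclideanSpace ℝ (Fin 2))} (h : IsAdmissible T κ m)
    (hfin : ∫⁻ z, ‖fluxDensity m (spaceTime T κ) z‖ₑ ^ 2 ∂(spaceTime T κ) ≠ ⊤)
    {φ : ℝ × Torus2 → ℝ} (hφ : IsTestFunction T φ) :
    -∫ z, timeDeriv φ z ∂(spaceTime T κ) ≤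
      (∫⁻ z, ‖fluxDensity m (spaceTime T κ) z‖ₑ ^ 2 ∂(spaceTime T κ)).toReal / 2 +
        (∫ z, ‖horGrad φ z‖ ^ 2 ∂(spaceTime T κ)) / 2 := by
  have := h.finite
  set μ := spaceTime T κ with hμ
  set v := fluxDensity m μ with hv
  have hvm : AEStronglyMeasurable v μ := (measurable_fluxDensity m μ).aestronglyMeasurable
  have hsq : ∀ z, ‖v z‖ₑ ^ 2 = ENNReal.ofReal (‖v z‖ ^ 2) := fun z => by
    rw [ENNReal.ofReal_pow (norm_nonneg _), ofReal_norm]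
  have hvint : Integrable (fun z => ‖v z‖ ^ 2) μ := by
    refine ⟨hvm.norm.pow 2, ?_⟩
    rw [hasFiniteIntegral_iff_ofReal (Eventually.of_forall fun z => by positivity)]
    simp_rw [← hsq]
    exact hfin.lt_top
  have hvA : (∫⁻ z, ‖v z‖ₑ ^ 2 ∂μ).toReal = ∫ z, ‖v z‖ ^ 2 ∂μ := by
    simp_rw [hsq]
    rw [integral_eq_lintegral_of_nonneg_ae (Eventually.of_forall fun z => by positivity)
      hvint.aestronglyMeasurable]
  have hgint : Integrable (fun z => ‖horGrad φ z‖ ^ 2) μ :=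
    (memLp_spaceTime T κ (g := fun z => ‖horGrad φ z‖ ^ 2)
      (hφ.smoothOnTorus.continuous_horGrad.norm.pow 2) 1).integrable le_rfl
  have hce := h.continuityEq φ hφ
  rw [← hμ, ← hv] at hce
  have hle : ∫ z, inner ℝ (horGrad φ z) (v z) ∂μ ≤
      ∫ z, (‖v z‖ ^ 2 / 2 + ‖horGrad φ z‖ ^ 2 / 2) ∂μ := by
    have hyoung : ∀ z, |inner ℝ (horGrad φ z) (v z)| ≤ ‖v z‖ ^ 2 / 2 + ‖horGrad φ z‖ ^ 2 / 2 := by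
      intro z
      have h1 := abs_real_inner_le_norm (horGrad φ z) (v z)
      nlinarith [sq_nonneg (‖horGrad φ z‖ - ‖v z‖)]
    have hi := (hvint.div_const 2).add (hgint.div_const 2)
    refine integral_mono (hi.mono' ?_ (Eventually.of_forall hyoung)) hi
      fun z => (le_abs_self _).trans (hyoung z)
    exact hφ.smoothOnTorus.continuous_horGrad.measurable.aestronglyMeasurable.inner hvm
  rw [integral_add (hvint.div_const 2) (hgint.div_const 2), integral_div, integral_div] at hle
  rw [hvA]
  linarith

/-- The dual bound on the action, for a smooth function localized in time by a cutoff `ψ`. -/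
theorem IsAdmissible.cutoff_le {T : ℝ} {κ : Kernel ℝ Torus2}
    {m : VectorMeasure (ℝ × Torus2) (EuclideanSpace ℝ (Fin 2))} (h : IsAdmissible T κ m)
    (hfin : ∫⁻ z, ‖fluxDensity m (spaceTime T κ) z‖ₑ ^ 2 ∂(spaceTime T κ) ≠ ⊤)
    {c : ℝ → Measure Torus2} [∀ t, IsFiniteMeasure (c t)]
    (hc : ∀ᵐ t ∂(volume.restrict (Ioo (-T) T)), κ t = c t) {s t : ℝ} (hs : -T ≤ s) (hst : s ≤ t)
    (ht : t ≤ T) {ψ : ℝ → ℝ} (hψ : ContDiff ℝ ∞ ψ) (hsupp : tsupport ψ ⊆ Ioo s t)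
    {f : ℝ × Torus2 → ℝ} (hf : SmoothOnTorus f) :
    -(∫ r in s..t, (deriv ψ r * (∫ x, f (r, x) ∂(c r)) + ψ r * ∫ x, timeDeriv f (r, x) ∂(c r))) ≤
      (∫⁻ z, ‖fluxDensity m (spaceTime T κ) z‖ₑ ^ 2 ∂(spaceTime T κ)).toReal / 2 +
        (∫ r in s..t, ψ r ^ 2 * ∫ x, ‖horGrad f (r, x)‖ ^ 2 ∂(c r)) / 2 := by
  have := h.finite
  have hsub : Ioo s t ⊆ Ioo (-T) T := Ioo_subset_Ioo hs ht
  have hφ := isTestFunction_mul_time hψ (hsupp.trans hsub) hf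
  have key := h.neg_integral_timeDeriv_le hfin hφ
  have hloc : ∀ {g : ℝ × Torus2 → ℝ} {G : ℝ → ℝ}, Continuous g →
      (∀ r, ∫ x, g (r, x) ∂(c r) = G r) → (∀ r, r ∉ tsupport ψ → G r = 0) →
      ∫ z, g z ∂(spaceTime T κ) = ∫ r in s..t, G r := by
    intro g G hg hG hz
    rw [integral_spaceTime T κ hg]
    have h1 : ∫ r in Ioo (-T) T, ∫ x, g (r, x) ∂(κ r) = ∫ r in Ioo (-T) T, G r := by
      refine integral_congr_ae ?_
      filter_upwards [hc] with r hr
      rw [hr, hG]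
    rw [h1, intervalIntegral.integral_of_le hst, integral_Ioc_eq_integral_Ioo]
    have hsG : ∀ r, r ∉ Ioo s t → G r = 0 := fun r hr => hz r fun hm => hr (hsupp hm)
    rw [setIntegral_eq_of_subset_of_forall_sdiff_eq_zero measurableSet_Ioo hsub
      fun r hr => hsG r hr.2]
  have hcs : ∀ (r : ℝ) {g : ℝ × Torus2 → ℝ}, Continuous g → Integrable (fun x => g (r, x)) (c r) :=
    fun r g hg => integrable_of_continuous (hg.comp (Continuous.prodMk_right r)) _
  have hz0 : ∀ r, r ∉ tsupport ψ → ψ r = 0 := fun r hr => image_eq_zero_of_notMem_tsupport hr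
  have hz1 : ∀ r, r ∉ tsupport ψ → deriv ψ r = 0 := fun r hr =>
    Function.notMem_support.1 fun hm => hr (support_deriv_subset hm)
  have e1 := hloc (G := fun r => deriv ψ r * (∫ x, f (r, x) ∂(c r)) +
      ψ r * ∫ x, timeDeriv f (r, x) ∂(c r)) hφ.smoothOnTorus.continuous_timeDeriv (fun r => by
      simp_rw [hf.timeDeriv_mul_time hψ]
      rw [integral_add ((hcs r hf.continuous).const_mul _)
        ((hcs r hf.continuous_timeDeriv).const_mul _), integral_const_mul, integral_const_mul])
    (fun r hr => by simp [hz0 r hr, hz1 r hr])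
  have e2 := hloc (g := fun z => ‖horGrad (fun z => ψ z.1 * f z) z‖ ^ 2)
    (G := fun r => ψ r ^ 2 * ∫ x, ‖horGrad f (r, x)‖ ^ 2 ∂(c r))
    (hφ.smoothOnTorus.continuous_horGrad.norm.pow 2) (fun r => by
      simp_rw [horGrad_mul_time, norm_smul, mul_pow, Real.norm_eq_abs, sq_abs]
      rw [integral_const_mul])
    (fun r hr => by simp [hz0 r hr])
  rw [e1, e2] at key
  exact key

/-- An admissible pair of finite flux energy is a flow. The representative given by the traces is a
curve of finite measures; testing with constants shows that its mass stays equal to one. -/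
theorem IsAdmissible.exists_flow {T : ℝ} (hT : 0 < T) {κ : Kernel ℝ Torus2}
    {m : VectorMeasure (ℝ × Torus2) (EuclideanSpace ℝ (Fin 2))} (h : IsAdmissible T κ m)
    (hfin : ∫⁻ z, ‖fluxDensity m (spaceTime T κ) z‖ₑ ^ 2 ∂(spaceTime T κ) ≠ ⊤)
    {α β : ProbabilityMeasure Torus2} (htr : HasTraces T κ α β) :
    ∃ c, IsFlow (-T) T c (∫⁻ t in Ioo (-T) T, ∑' x : Torus2, (κ t {x}) ^ (1 / 2 : ℝ))
      (∫⁻ z, ‖fluxDensity m (spaceTime T κ) z‖ₑ ^ 2 ∂(spaceTime T κ)).toReal ∧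
      c (-T) = α ∧ c T = β := by
  have hTT : -T ≤ T := by linarith
  set A := (∫⁻ z, ‖fluxDensity m (spaceTime T κ) z‖ₑ ^ 2 ∂(spaceTime T κ)).toReal with hA
  obtain ⟨c, hcc, hcκ, hcα, hcβ⟩ := htr
  set d : ℝ → FiniteMeasure Torus2 := fun t => c (projIcc (-T) T hTT t) with hd
  have hdc : Continuous d := by
    have h1 := continuousOn_iff_continuous_domRestrict.1 hcc
    exact h1.comp continuous_projIcc
  have hde : ∀ t ∈ Icc (-T) T, d t = c t := fun t ht => by
    rw [hd]
    simp only [projIcc_of_mem hTT ht]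
  have hκd : ∀ᵐ t ∂(volume.restrict (Ioo (-T) T)), κ t = (d t : Measure Torus2) := by
    filter_upwards [hcκ, ae_restrict_mem measurableSet_Ioo] with t ht htm
    rw [ht, hde t (Ioo_subset_Icc_self htm)]
  have hmassr : ∀ t, ((d t : Measure Torus2)).real univ = (d t).mass := fun t => rfl
  have hmass0 : ((d (-T)).mass : ℝ) = 1 := by
    rw [← hmassr, hde _ ⟨le_rfl, hTT⟩, hcα]
    exact probReal_univ
  have hmass : ∀ t ∈ Icc (-T) T, ((d t).mass : ℝ) = 1 := by
    intro t ht
    rcases ht.1.eq_or_lt with rfl | hlt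
    · exact hmass0
    -- testing with an arbitrary constant `l` shows that the mass does not change
    have hl : ∀ l : ℝ, l * (d t).mass - l * (d (-T)).mass ≤ A / 2 := by
      intro l
      have hmc : Continuous fun r => l * ((d r).mass : ℝ) :=
        continuous_const.mul (NNReal.continuous_coe.comp (FiniteMeasure.continuous_mass.comp hdc))
      have := sub_le_of_forall_cutoff (g := fun _ => 0) (R := A / 2) hmc continuous_const hlt
        fun ψ hψ _ hsupp => by
          have hsm : SmoothOnTorus fun _ => l := contDiff_const
          have h1 := h.cutoff_le hfin hκd le_rfl ht.1 ht.2 hψ hsupp hsm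
          have hg0 : horGrad (fun _ : ℝ × Torus2 => l) = 0 := by
            funext z
            ext i
            simp [horGrad]
          have ht0 : timeDeriv (fun _ : ℝ × Torus2 => l) = 0 := by
            funext z
            simp [timeDeriv]
          simp only [hg0, ht0, Pi.zero_apply, integral_zero, norm_zero, integral_const, hmassr,
            smul_eq_mul, mul_zero, add_zero, ne_eq, OfNat.ofNat_ne_zero, not_false_eq_true,
            zero_pow, intervalIntegral.integral_zero, zero_div] at h1
          simp only [mul_zero, intervalIntegral.integral_zero, sub_zero]
          rw [← hA] at h1
          simpa only [mul_comm l] using h1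
      simpa using this
    by_contra hne
    have hne' : ((d t).mass : ℝ) - 1 ≠ 0 := sub_ne_zero.2 hne
    have := hl ((A / 2 + 1) / ((d t).mass - 1))
    rw [← mul_sub, hmass0, div_mul_cancel₀ _ hne'] at this
    linarith
  have hprob : ∀ t, IsProbabilityMeasure (d t : Measure Torus2) := by
    intro t
    constructor
    have h1 := hmass (projIcc (-T) T hTT t) (projIcc (-T) T hTT t).2
    have h2 : d (projIcc (-T) T hTT t) = d t := by simp [hd]
    rw [h2, ← hmassr, measureReal_def] at h1
    rw [← ENNReal.ofReal_toReal (measure_ne_top (d t : Measure Torus2) univ), h1,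
      ENNReal.ofReal_one]
  set p : ℝ → ProbabilityMeasure Torus2 := fun t => ⟨(d t : Measure Torus2), hprob t⟩ with hp
  have hpd : ∀ t, (p t : Measure Torus2) = (d t : Measure Torus2) := fun t => rfl
  have hpc : Continuous p := (ProbabilityMeasure.toFiniteMeasure_isEmbedding Torus2).continuous_iff.2
    (hdc.congr fun t => rfl)
  have hκp : ∀ᵐ t ∂(volume.restrict (Ioo (-T) T)), κ t = (p t : Measure Torus2) := hκd
  refine ⟨p, ⟨hpc, ?_, ?_⟩, ?_, ?_⟩
  · refine lintegral_mono_ae ?_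
    filter_upwards [hκp, h.discrete] with t ht hdisc
    rw [ht] at hdisc ⊢
    exact sqrtMass_le_tsum hdisc
  · intro f hf s t hs hst ht
    rcases hst.eq_or_lt with rfl | hlt
    · rw [flowExcess_self]
      have : 0 ≤ A := ENNReal.toReal_nonneg
      linarith
    have hc0 := continuous_slice_integral hpc hf.continuous
    have hc1 := continuous_slice_timeDeriv hpc hf
    have hc2 := continuous_slice_horGrad_sq hpc hf
    have := sub_le_of_forall_cutoff (R := A / 2 + (∫ r in s..t, ∫ x, ‖horGrad f (r, x)‖ ^ 2
      ∂(p r : Measure Torus2)) / 2) hc0 hc1 hlt fun ψ hψ h01 hsupp => by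
        have h1 := h.cutoff_le hfin hκp hs hst ht hψ hsupp hf
        have hψc := hψ.continuous
        have hdψ : Continuous (deriv ψ) := hψ.continuous_deriv (by simp)
        rw [intervalIntegral.integral_add ((hdψ.fun_mul hc0).intervalIntegrable _ _)
          ((hψc.fun_mul hc1).intervalIntegrable _ _)] at h1
        have h2 : ∫ r in s..t, ψ r ^ 2 * ∫ x, ‖horGrad f (r, x)‖ ^ 2 ∂(p r : Measure Torus2) ≤
            ∫ r in s..t, ∫ x, ‖horGrad f (r, x)‖ ^ 2 ∂(p r : Measure Torus2) := by
          refine intervalIntegral.integral_mono_on hst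
            (((hψc.pow 2).mul hc2).intervalIntegrable _ _) (hc2.intervalIntegrable _ _)
            fun r _ => mul_le_of_le_one_left (integral_nonneg fun x => by positivity) ?_
          exact pow_le_one₀ (h01 r).1 (h01 r).2
        linarith
    rw [flowExcess]
    linarith
  · apply ProbabilityMeasure.toMeasure_injective
    rw [hpd, hde _ ⟨le_rfl, hTT⟩, hcα]
  · apply ProbabilityMeasure.toMeasure_injective
    rw [hpd, hde _ ⟨hTT, le_rfl⟩, hcβ]

/-! ### Dyadic grids, branching, and sparse transport plans -/

/-- Two measures are `FlowJoined` in time `ℓ` with irrigation cost `P` and action `A` if on every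
interval of length `ℓ` some flow with these bounds leads from the first to the second. Quantifying
over all starting times makes the notion invariant under time shifts by definition. -/
def FlowJoined (ℓ : ℝ) (α β : ProbabilityMeasure Torus2) (P A : ℝ) : Prop :=
  ∀ a, ∃ c, IsFlow a (a + ℓ) c (ENNReal.ofReal P) A ∧ c a = α ∧ c (a + ℓ) = β

theorem FlowJoined.trans {ℓ ℓ' P P' A A' : ℝ} {α β γ : ProbabilityMeasure Torus2} (hℓ : 0 ≤ ℓ)
    (hℓ' : 0 ≤ ℓ') (hP : 0 ≤ P) (hP' : 0 ≤ P') (h : FlowJoined ℓ α β P A) (h' : FlowJoined ℓ' β γ P' A') :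
    FlowJoined (ℓ + ℓ') α γ (P + P') (A + A') := by
  intro a
  obtain ⟨c, hc, hca, hcb⟩ := h a
  obtain ⟨c', hc', hca', hcb'⟩ := h' (a + ℓ)
  have hmid : c (a + ℓ) = c' (a + ℓ) := hcb.trans hca'.symm
  refine ⟨fun t => if t ≤ a + ℓ then c t else c' t, ?_, ?_, ?_⟩
  · rw [ENNReal.ofReal_add hP hP', ← add_assoc]
    exact hc.concat (by linarith) (by linarith) hc' hmid
  · simp only [le_add_iff_nonneg_right, hℓ, if_true, hca]
  · rcases hℓ'.eq_or_lt with h0 | hlt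
    · subst h0
      simp only [add_zero, le_refl, if_true, hmid]
      simpa using hcb'
    · simp only [add_le_add_iff_left, add_le_iff_nonpos_right, not_le.2 hlt, if_false]
      rw [← add_assoc]
      exact hcb'

theorem FlowJoined.mono {ℓ P P' A A' : ℝ} {α β : ProbabilityMeasure Torus2} (h : FlowJoined ℓ α β P A)
    (hP : P ≤ P') (hA : A ≤ A') : FlowJoined ℓ α β P' A' := by
  intro a
  obtain ⟨c, hc, hca, hcb⟩ := h a
  exact ⟨c, hc.mono (ENNReal.ofReal_le_ofReal hP) hA, hca, hcb⟩

theorem flowJoined_pointLaw {ι : Type*} [Fintype ι] [MeasurableSpace ι] [MeasurableSingletonClass ι]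
    (p : ProbabilityMeasure ι) (X Y : ι → EuclideanSpace ℝ (Fin 2)) {ℓ : ℝ} (hℓ : 0 < ℓ) :
    FlowJoined ℓ (pointLaw p X) (pointLaw p Y) (ℓ * √(Fintype.card ι))
      ((∑ i, (p : Measure ι).real {i} * ‖Y i - X i‖ ^ 2) / ℓ) := by
  intro a
  have := exists_segment_flow p X Y (show a < a + ℓ by linarith)
  rwa [add_sub_cancel_left] at this

section Grid

/-- The index set of the `4 ^ k` dyadic cells of side `2 ^ (-k)`. -/
abbrev Cell (k : ℕ) : Type := Fin 2 → Fin (2 ^ k)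

/-- The representative in `[0, 1)` of a point of the circle. -/
def circleRep (x : UnitAddCircle) : ℝ := AddCircle.equivIco 1 0 x

theorem circleRep_mem (x : UnitAddCircle) : circleRep x ∈ Ico (0 : ℝ) 1 := by
  have h := (AddCircle.equivIco (1 : ℝ) 0 x).2
  exact ⟨h.1, h.2.trans_eq (zero_add 1)⟩

theorem coe_circleRep (x : UnitAddCircle) : (circleRep x : UnitAddCircle) = x :=
  (AddCircle.equivIco (1 : ℝ) 0).symm_apply_apply x

theorem measurable_circleRep : Measurable circleRep :=
  measurable_subtype_coe.comp (AddCircle.measurableEquivIco 1 0).measurable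

/-- The dyadic cell of level `k` that contains `x`. -/
def cellOf (k : ℕ) (x : Torus2) : Cell k := fun i =>
  ⟨⌊circleRep (x i) * 2 ^ k⌋₊, by
    have h := circleRep_mem (x i)
    rw [Nat.floor_lt (mul_nonneg h.1 (by positivity))]
    push_cast
    exact mul_lt_of_lt_one_left (by positivity) h.2⟩

theorem measurable_cellOf (k : ℕ) : Measurable (cellOf k) := by
  refine measurable_pi_lambda _ fun i => measurable_to_countable' fun j => ?_
  have hm : Measurable fun x : Torus2 => ⌊circleRep (x i) * 2 ^ k⌋₊ :=
    Nat.measurable_floor.comp ((measurable_circleRep.comp (measurable_pi_apply i)).mul_const _)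
  have : (fun x : Torus2 => cellOf k x i) ⁻¹' {j} =
      (fun x : Torus2 => ⌊circleRep (x i) * 2 ^ k⌋₊) ⁻¹' {(j : ℕ)} := by
    ext x
    simp [cellOf, Fin.ext_iff]
  rw [this]
  exact hm (measurableSet_singleton _)

/-- The lower left corner of a dyadic cell. -/
def corner (k : ℕ) (c : Cell k) : EuclideanSpace ℝ (Fin 2) :=
  WithLp.toLp 2 fun i => (c i : ℝ) / 2 ^ k

/-- The cell of level `k` that contains a given cell of level `k + 1`. -/
def parentCell (k : ℕ) (c : Cell (k + 1)) : Cell k := fun i =>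
  ⟨c i / 2, Nat.div_lt_of_lt_mul ((c i).2.trans_eq (by rw [pow_succ, mul_comm]))⟩

theorem parentCell_cellOf (k : ℕ) (x : Torus2) : parentCell k (cellOf (k + 1) x) = cellOf k x := by
  funext i
  apply Fin.ext
  simp only [parentCell, cellOf]
  rw [← Nat.floor_div_ofNat]
  congr 1
  rw [pow_succ]
  ring

theorem norm_corner_parentCell_sub_sq_le (k : ℕ) (c : Cell (k + 1)) :
    ‖corner k (parentCell k c) - corner (k + 1) c‖ ^ 2 ≤ 1 / (2 * 4 ^ k) := by
  rw [EuclideanSpace.norm_sq_eq]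
  have h : ∀ i, ‖(corner k (parentCell k c) - corner (k + 1) c) i‖ ^ 2 ≤ 1 / (4 * 4 ^ k) := by
    intro i
    have hval : (corner k (parentCell k c) - corner (k + 1) c) i =
        -(((c i : ℕ) % 2 : ℕ) : ℝ) / (2 * 2 ^ k) := by
      simp only [corner, parentCell, PiLp.sub_apply]
      have hpow : (2 : ℝ) ^ (k + 1) = 2 * 2 ^ k := by rw [pow_succ, mul_comm]
      have := Nat.div_add_mod (c i : ℕ) 2
      have h2 : ((c i : ℕ) : ℝ) = 2 * (((c i : ℕ) / 2 : ℕ) : ℝ) + (((c i : ℕ) % 2 : ℕ) : ℝ) := by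
        exact_mod_cast this.symm
      rw [h2, hpow]
      field_simp
      ring
    have hmod : (((c i : ℕ) % 2 : ℕ) : ℝ) ≤ 1 := by
      exact_mod_cast Nat.lt_succ_iff.1 (Nat.mod_lt (c i : ℕ) two_pos)
    rw [hval, Real.norm_eq_abs, sq_abs, div_pow, neg_sq,
      show ((2 : ℝ) * 2 ^ k) ^ 2 = 4 * 4 ^ k by rw [mul_pow, ← pow_mul, mul_comm k, pow_mul]; norm_num]
    gcongr
    exact pow_le_one₀ (by positivity) hmod
  refine (Finset.sum_le_sum fun i _ => h i).trans (le_of_eq ?_)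
  rw [Fin.sum_univ_two]
  field_simp
  norm_num

theorem norm_coe_le_abs (x : ℝ) : ‖(x : UnitAddCircle)‖ ≤ |x| := by
  rw [UnitAddCircle.norm_eq]
  simpa using round_le x 0

theorem norm_corner_cellOf_sub_le (k : ℕ) (x : Torus2) (i : Fin 2) :
    ‖torusMk (corner k (cellOf k x)) i - x i‖ ≤ 1 / 2 ^ k := by
  have h1 : torusMk (corner k (cellOf k x)) i - x i =
      ((corner k (cellOf k x) i - circleRep (x i) : ℝ) : UnitAddCircle) := by
    rw [AddCircle.coe_sub, coe_circleRep]
    rfl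
  rw [h1]
  refine (norm_coe_le_abs _).trans ?_
  have hnn : 0 ≤ circleRep (x i) * 2 ^ k := mul_nonneg (circleRep_mem _).1 (by positivity)
  have h2 := Nat.floor_le hnn
  have h3 := Nat.lt_floor_add_one (circleRep (x i) * 2 ^ k)
  have h4 : corner k (cellOf k x) i - circleRep (x i) =
      ((⌊circleRep (x i) * 2 ^ k⌋₊ : ℝ) - circleRep (x i) * 2 ^ k) / 2 ^ k := by
    simp only [corner, cellOf]
    field_simp
  rw [h4, abs_div, abs_of_pos (show (0 : ℝ) < 2 ^ k by positivity)]
  gcongr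
  rw [abs_le]
  constructor <;> linarith

/-- The law of the dyadic cell of level `k` under `α`. -/
def cellLaw (k : ℕ) (α : ProbabilityMeasure Torus2) : ProbabilityMeasure (Cell k) :=
  α.map (measurable_cellOf k).aemeasurable

/-- The discretization of `α` on the dyadic grid of level `k`. -/
def gridApprox (k : ℕ) (α : ProbabilityMeasure Torus2) : ProbabilityMeasure Torus2 :=
  pointLaw (cellLaw k α) (corner k)

theorem coe_gridApprox (k : ℕ) (α : ProbabilityMeasure Torus2) :
    (gridApprox k α : Measure Torus2) =
      (α : Measure Torus2).map fun x => torusMk (corner k (cellOf k x)) :=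
  Measure.map_map (measurable_of_finite fun c => torusMk (corner k c)) (measurable_cellOf k)

theorem pointLaw_parentCell (k : ℕ) (α : ProbabilityMeasure Torus2) :
    pointLaw (cellLaw (k + 1) α) (fun c => corner k (parentCell k c)) = gridApprox k α := by
  apply ProbabilityMeasure.toMeasure_injective
  rw [coe_gridApprox]
  refine (Measure.map_map (measurable_of_finite fun c => torusMk (corner k (parentCell k c)))
    (measurable_cellOf (k + 1))).trans ?_
  congr 1
  funext x
  simp only [Function.comp, parentCell_cellOf]

theorem tendsto_gridApprox (α : ProbabilityMeasure Torus2) :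
    Tendsto (fun k => gridApprox k α) atTop (𝓝 α) := by
  rw [ProbabilityMeasure.tendsto_iff_forall_integral_tendsto]
  intro g
  have hm : ∀ k, Measurable fun x => torusMk (corner k (cellOf k x)) := fun k =>
    (measurable_of_finite fun c => torusMk (corner k c)).comp (measurable_cellOf k)
  have hint : ∀ k, ∫ x, g x ∂(gridApprox k α : Measure Torus2) =
      ∫ x, g (torusMk (corner k (cellOf k x))) ∂(α : Measure Torus2) := fun k => by
    rw [coe_gridApprox, integral_map (hm k).aemeasurable
      g.continuous.measurable.aestronglyMeasurable]
  simp_rw [hint]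
  refine tendsto_integral_of_dominated_convergence (fun _ => ‖g‖)
    (fun k => (g.continuous.measurable.comp (hm k)).aestronglyMeasurable) (integrable_const _)
    (fun k => Eventually.of_forall fun x => g.norm_coe_le_norm _)
    (Eventually.of_forall fun x => ?_)
  refine (g.continuous.tendsto x).comp (tendsto_pi_nhds.2 fun i => ?_)
  refine tendsto_iff_norm_sub_tendsto_zero.2 (squeeze_zero (fun _ => norm_nonneg _)
    (fun k => norm_corner_cellOf_sub_le k x i) ?_)
  simp_rw [← one_div_pow]
  exact tendsto_pow_atTop_nhds_zero_of_lt_one (by norm_num) (by norm_num)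

theorem sqrt_card_cell (k : ℕ) : √(Fintype.card (Cell k) : ℝ) = 2 ^ k := by
  rw [Fintype.card_fun, Fintype.card_fin, Fintype.card_fin]
  push_cast
  exact Real.sqrt_sq (by positivity)

theorem sum_real_singleton {ι : Type*} [Fintype ι] [MeasurableSpace ι] [MeasurableSingletonClass ι]
    (p : ProbabilityMeasure ι) : ∑ i, (p : Measure ι).real {i} = 1 := by
  rw [sum_measureReal_singleton, Finset.coe_univ, probReal_univ]

theorem flowJoined_gridApprox_self (k : ℕ) (α : ProbabilityMeasure Torus2) {ℓ : ℝ} (hℓ : 0 < ℓ) :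
    FlowJoined ℓ (gridApprox k α) (gridApprox k α) (ℓ * 2 ^ k) 0 := by
  have := flowJoined_pointLaw (cellLaw k α) (corner k) (corner k) hℓ
  rw [sqrt_card_cell] at this
  simpa [gridApprox] using this

/-- One branching step, in both directions of time. -/
theorem flowJoined_gridApprox_succ (k : ℕ) (α : ProbabilityMeasure Torus2) {ℓ : ℝ} (hℓ : 0 < ℓ) :
    FlowJoined ℓ (gridApprox (k + 1) α) (gridApprox k α) (ℓ * 2 ^ (k + 1)) (1 / (2 * 4 ^ k) / ℓ) ∧
    FlowJoined ℓ (gridApprox k α) (gridApprox (k + 1) α) (ℓ * 2 ^ (k + 1)) (1 / (2 * 4 ^ k) / ℓ) := by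
  have h1 := flowJoined_pointLaw (cellLaw (k + 1) α) (corner (k + 1))
    (fun c => corner k (parentCell k c)) hℓ
  have h2 := flowJoined_pointLaw (cellLaw (k + 1) α) (fun c => corner k (parentCell k c))
    (corner (k + 1)) hℓ
  rw [sqrt_card_cell, pointLaw_parentCell] at h1 h2
  have hsum : ∑ c, (cellLaw (k + 1) α : Measure (Cell (k + 1))).real {c} *
      ‖corner k (parentCell k c) - corner (k + 1) c‖ ^ 2 ≤ 1 / (2 * 4 ^ k) := by
    calc _ ≤ ∑ c, (cellLaw (k + 1) α : Measure (Cell (k + 1))).real {c} * (1 / (2 * 4 ^ k)) :=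
          Finset.sum_le_sum fun c _ => mul_le_mul_of_nonneg_left
            (norm_corner_parentCell_sub_sq_le k c) measureReal_nonneg
      _ = 1 / (2 * 4 ^ k) := by rw [← Finset.sum_mul, sum_real_singleton, one_mul]
  refine ⟨h1.mono le_rfl (by gcongr), h2.mono le_rfl ?_⟩
  simp_rw [norm_sub_rev (corner (k + 1) _)]
  gcongr

/-- The branching construction: a discretization at an arbitrarily fine level `k + i` is joined with
the discretization at level `k` at a cost that does not depend on `i`. The time spent on each level
is a third of the time spent on the next coarser one, so that both the irrigation cost and the
action of the levels decay geometrically. -/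
theorem flowJoined_gridApprox_add (α : ProbabilityMeasure Torus2) (i : ℕ) : ∀ (k : ℕ) {τ : ℝ}, 0 < τ →
    FlowJoined (3 * τ / 2) (gridApprox (k + i) α) (gridApprox k α) (6 * τ * 2 ^ k) (2 / (4 ^ k * τ)) ∧
    FlowJoined (3 * τ / 2) (gridApprox k α) (gridApprox (k + i) α) (6 * τ * 2 ^ k)
      (2 / (4 ^ k * τ)) := by
  induction i with
  | zero =>
    intro k τ hτ
    have h := (flowJoined_gridApprox_self k α (show 0 < 3 * τ / 2 by positivity)).mono
      (P' := 6 * τ * 2 ^ k) (A' := 2 / (4 ^ k * τ)) (by gcongr; linarith) (by positivity)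
    exact ⟨h, h⟩
  | succ i ih =>
    intro k τ hτ
    obtain ⟨h1, h2⟩ := ih (k + 1) (show 0 < τ / 3 by positivity)
    obtain ⟨h3, h4⟩ := flowJoined_gridApprox_succ k α hτ
    rw [add_right_comm, add_assoc] at h1 h2
    have hℓ : 3 * (τ / 3) / 2 + τ = 3 * τ / 2 := by ring
    have hP : 6 * (τ / 3) * 2 ^ (k + 1) + τ * 2 ^ (k + 1) = 6 * τ * 2 ^ k := by ring
    have hA : 2 / (4 ^ (k + 1) * (τ / 3)) + 1 / (2 * 4 ^ k) / τ = 2 / (4 ^ k * τ) := by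
      field_simp
      ring
    constructor
    · have := h1.trans (by positivity) hτ.le (by positivity) (by positivity) h3
      rwa [hℓ, hP, hA] at this
    · have := h4.trans hτ.le (by positivity) (by positivity) (by positivity) h2
      rwa [add_comm τ, hℓ, add_comm (τ * _), hP, add_comm (1 / _ / τ), hA] at this

end Grid

section SparsePlan

universe u

/-- By Carathéodory's theorem, a transport plan between measures on a finite set may be replaced by
one with the same marginals and the same cost, whose number of atoms is linear in the number of
points. -/
theorem exists_sparse_plan {ι : Type u} [Fintype ι] [DecidableEq ι] {q : ι × ι → ℝ}
    (hq : ∀ z, 0 ≤ q z) (hq1 : ∑ z, q z = 1) (D : ι × ι → ℝ) :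
    ∃ (J : Type u) (_ : Fintype J) (e : J → ι × ι) (w : J → ℝ), (∀ j, 0 ≤ w j) ∧ ∑ j, w j = 1 ∧
      Fintype.card J ≤ 2 * Fintype.card ι + 2 ∧
      (∀ i, ∑ j, (if (e j).1 = i then w j else 0) = ∑ z, if z.1 = i then q z else 0) ∧
      (∀ i, ∑ j, (if (e j).2 = i then w j else 0) = ∑ z, if z.2 = i then q z else 0) ∧
      ∑ j, w j * D (e j) = ∑ z, q z * D z := by
  set Z : ι × ι → (ι → ℝ) × (ι → ℝ) × ℝ := fun z => (Pi.single z.1 1, Pi.single z.2 1, D z) with hZ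
  have hmem : ∑ z, q z • Z z ∈ convexHull ℝ (range Z) :=
    (convex_convexHull ℝ _).sum_mem (fun z _ => hq z) hq1
      fun z _ => subset_convexHull ℝ _ (mem_range_self z)
  obtain ⟨J, hJ, p, w, hp, hind, hw, hw1, hsum⟩ := eq_pos_convex_span_of_mem_convexHull hmem
  choose e he using fun j => hp (mem_range_self j)
  refine ⟨J, hJ, e, w, fun j => (hw j).le, hw1, ?_, ?_, ?_, ?_⟩
  · refine hind.card_le_finrank_succ.trans ?_
    refine (Nat.succ_le_succ (Submodule.finrank_le _)).trans ?_
    simp only [Module.finrank_prod, Module.finrank_fintype_fun_eq_card, Module.finrank_self]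
    omega
  · intro i
    have := congrFun (congrArg Prod.fst hsum) i
    simp only [← he, hZ, Prod.fst_sum, Finset.sum_apply, Prod.smul_fst, Pi.smul_apply,
      Pi.single_apply, smul_eq_mul, mul_ite, mul_one, mul_zero] at this
    simpa only [eq_comm (a := i)] using this
  · intro i
    have := congrFun (congrArg (fun v => v.2.1) hsum) i
    simp only [← he, hZ, Prod.snd_sum, Prod.fst_sum, Finset.sum_apply, Prod.smul_snd, Prod.smul_fst,
      Pi.smul_apply, Pi.single_apply, smul_eq_mul, mul_ite, mul_one, mul_zero] at this
    simpa only [eq_comm (a := i)] using this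
  · have := congrArg (fun v => v.2.2) hsum
    simpa only [← he, hZ, Prod.snd_sum, Prod.smul_snd, smul_eq_mul] using this

/-- Two particle systems have the same law if the particles of the first, grouped by their position
`e j`, have the weights of the second. The lifts to `ℝ²` may differ by integers. -/
theorem pointLaw_comp_eq {ι J : Type*} [Fintype ι] [MeasurableSpace ι] [MeasurableSingletonClass ι]
    [DecidableEq ι] [Fintype J] [MeasurableSpace J] [MeasurableSingletonClass J]
    (p : ProbabilityMeasure J) (p' : ProbabilityMeasure ι) (e : J → ι)
    (h : ∀ i, ∑ j, (if e j = i then (p : Measure J).real {j} else 0) = (p' : Measure ι).real {i})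
    (X : ι → EuclideanSpace ℝ (Fin 2)) {Y : J → EuclideanSpace ℝ (Fin 2)}
    (hY : ∀ j, torusMk (Y j) = torusMk (X (e j))) : pointLaw p Y = pointLaw p' X := by
  apply ProbabilityMeasure.toMeasure_injective
  refine ext_of_forall_integral_eq_of_IsFiniteMeasure fun g => ?_
  rw [integral_pointLaw _ _ g.continuous, integral_pointLaw _ _ g.continuous]
  simp_rw [← h, Finset.sum_mul, hY]
  rw [Finset.sum_comm]
  refine Finset.sum_congr rfl fun j _ => ?_
  simp

/-- The representative of `torusMk v` closest to `u`. -/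
def nearestLift (u v : EuclideanSpace ℝ (Fin 2)) : EuclideanSpace ℝ (Fin 2) :=
  WithLp.toLp 2 fun i => v i + round (u i - v i)

theorem torusMk_nearestLift (u v : EuclideanSpace ℝ (Fin 2)) :
    torusMk (nearestLift u v) = torusMk v := by
  funext i
  simp [torusMk, nearestLift]

theorem norm_nearestLift_sub_sq (u v : EuclideanSpace ℝ (Fin 2)) :
    ‖nearestLift u v - u‖ ^ 2 = perDistSq (torusMk u) (torusMk v) := by
  rw [EuclideanSpace.norm_sq_eq, perDistSq]
  refine Finset.sum_congr rfl fun i _ => ?_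
  have h1 : torusMk u i - torusMk v i = ((u i - v i : ℝ) : UnitAddCircle) := by
    rw [AddCircle.coe_sub]
    rfl
  rw [h1, UnitAddCircle.norm_eq, Real.norm_eq_abs, ← abs_neg]
  congr 2
  simp only [nearestLift, PiLp.sub_apply]
  ring

theorem continuous_perDistSq : Continuous fun p : Torus2 × Torus2 => perDistSq p.1 p.2 := by
  unfold perDistSq
  fun_prop

/-- Discretizing both points changes the squared periodic distance little. -/
theorem perDistSq_corner_le (k : ℕ) (x y : Torus2) {δ : ℝ} (hδ : 0 < δ) :
    perDistSq (torusMk (corner k (cellOf k x))) (torusMk (corner k (cellOf k y))) ≤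
      (1 + δ) * perDistSq x y + (1 + 1 / δ) * (8 / 4 ^ k) := by
  have h : ∀ i, ‖torusMk (corner k (cellOf k x)) i - torusMk (corner k (cellOf k y)) i‖ ^ 2 ≤
      (1 + δ) * ‖x i - y i‖ ^ 2 + (1 + 1 / δ) * (4 / 4 ^ k) := by
    intro i
    set a := ‖x i - y i‖
    set b : ℝ := 1 / 2 ^ k with hb
    have h1 : ‖torusMk (corner k (cellOf k x)) i - torusMk (corner k (cellOf k y)) i‖ ≤
        a + 2 * b := by
      have e : torusMk (corner k (cellOf k x)) i - torusMk (corner k (cellOf k y)) i =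
          (x i - y i) + (torusMk (corner k (cellOf k x)) i - x i) -
            (torusMk (corner k (cellOf k y)) i - y i) := by abel
      rw [e]
      refine (norm_sub_le _ _).trans ?_
      have h2 := norm_corner_cellOf_sub_le k x i
      have h3 := norm_corner_cellOf_sub_le k y i
      have h4 := norm_add_le (x i - y i) (torusMk (corner k (cellOf k x)) i - x i)
      linarith
    have hb2 : 4 / 4 ^ k = (2 * b) ^ 2 := by
      rw [hb, mul_pow, one_div_pow, ← pow_mul, mul_comm k, pow_mul]
      norm_num
      ring
    rw [hb2]
    refine (pow_le_pow_left₀ (norm_nonneg _) h1 2).trans ?_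
    have h5 : (1 + δ) * a ^ 2 + (1 + 1 / δ) * (2 * b) ^ 2 - (a + 2 * b) ^ 2 =
        (δ * a - 2 * b) ^ 2 / δ := by
      field_simp
      ring
    have h6 : 0 ≤ (δ * a - 2 * b) ^ 2 / δ := by positivity
    linarith
  unfold perDistSq
  refine (Finset.sum_le_sum fun i _ => h i).trans (le_of_eq ?_)
  rw [Finset.sum_add_distrib, ← Finset.mul_sum, Finset.sum_const, Finset.card_univ,
    Fintype.card_fin, nsmul_eq_mul]
  push_cast
  ring

/-- Grid discretizations of the marginals of `π` are joined along straight lines, with the number of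
particles controlled by the size of the grid and the action controlled by the cost of `π`. -/
theorem flowJoined_of_plan (k : ℕ) {α β : ProbabilityMeasure Torus2}
    (π : ProbabilityMeasure (Torus2 × Torus2)) (hα : (π : Measure (Torus2 × Torus2)).fst = α)
    (hβ : (π : Measure (Torus2 × Torus2)).snd = β) {ℓ δ : ℝ} (hℓ : 0 < ℓ) (hδ : 0 < δ) :
    FlowJoined ℓ (gridApprox k α) (gridApprox k β) (ℓ * (2 * 2 ^ k))
      (((1 + δ) * ∫ z, perDistSq z.1 z.2 ∂(π : Measure (Torus2 × Torus2)) +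
        (1 + 1 / δ) * (8 / 4 ^ k)) / ℓ) := by
  have hm : Measurable fun z : Torus2 × Torus2 => (cellOf k z.1, cellOf k z.2) :=
    ((measurable_cellOf k).comp measurable_fst).prodMk ((measurable_cellOf k).comp measurable_snd)
  set q : ProbabilityMeasure (Cell k × Cell k) := π.map hm.aemeasurable with hq
  have hqm : (q : Measure (Cell k × Cell k)) =
      (π : Measure (Torus2 × Torus2)).map fun z => (cellOf k z.1, cellOf k z.2) := rfl
  set D : Cell k × Cell k → ℝ := fun z =>
    perDistSq (torusMk (corner k z.1)) (torusMk (corner k z.2)) with hD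
  obtain ⟨J, hJ, e, w, hw0, hw1, hcard, hfst, hsnd, hcost⟩ :=
    exists_sparse_plan (q := fun z => (q : Measure (Cell k × Cell k)).real {z})
      (fun z => measureReal_nonneg) (sum_real_singleton q) D
  let : MeasurableSpace J := ⊤
  have : MeasurableSingletonClass J := ⟨fun _ => trivial⟩
  obtain ⟨p, hp⟩ : ∃ p : ProbabilityMeasure J, ∀ j, (p : Measure J).real {j} = w j := by
    have hsum : ∑ j, ENNReal.ofReal (w j) = 1 := by
      rw [← ENNReal.ofReal_sum_of_nonneg fun j _ => hw0 j, hw1, ENNReal.ofReal_one]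
    refine ⟨⟨(PMF.ofFintype _ hsum).toMeasure, PMF.toMeasure.isProbabilityMeasure _⟩, fun j => ?_⟩
    rw [measureReal_def, ProbabilityMeasure.coe_mk,
      PMF.toMeasure_apply_singleton _ _ (measurableSet_singleton j), PMF.ofFintype_apply,
      ENNReal.toReal_ofReal (hw0 j)]
  have hmarg : ∀ (P : Cell k × Cell k → Prop) [DecidablePred P],
      ∑ z, (if P z then (q : Measure (Cell k × Cell k)).real {z} else 0) =
        (q : Measure (Cell k × Cell k)).real {z | P z} := by
    intro P _
    rw [← Finset.sum_filter, sum_measureReal_singleton]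
    simp
  have hX : pointLaw p (fun j => corner k (e j).1) = gridApprox k α := by
    refine pointLaw_comp_eq p (cellLaw k α) (fun j => (e j).1) (fun i => ?_) _ fun j => rfl
    simp_rw [hp]
    rw [hfst, hmarg, measureReal_def, measureReal_def]
    congr 1
    have : (cellLaw k α : Measure (Cell k)) = (α : Measure Torus2).map (cellOf k) := rfl
    rw [this, ← hα, Measure.fst, Measure.map_map (measurable_cellOf k) measurable_fst, hqm,
      Measure.map_apply hm (Set.toFinite _).measurableSet,
      Measure.map_apply ((measurable_cellOf k).comp measurable_fst) (measurableSet_singleton i)]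
    rfl
  have hY : pointLaw p (fun j => nearestLift (corner k (e j).1) (corner k (e j).2)) =
      gridApprox k β := by
    refine pointLaw_comp_eq p (cellLaw k β) (fun j => (e j).2) (fun i => ?_) _
      fun j => torusMk_nearestLift _ _
    simp_rw [hp]
    rw [hsnd, hmarg, measureReal_def, measureReal_def]
    congr 1
    have : (cellLaw k β : Measure (Cell k)) = (β : Measure Torus2).map (cellOf k) := rfl
    rw [this, ← hβ, Measure.snd, Measure.map_map (measurable_cellOf k) measurable_snd, hqm,
      Measure.map_apply hm (Set.toFinite _).measurableSet,
      Measure.map_apply ((measurable_cellOf k).comp measurable_snd) (measurableSet_singleton i)]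
    rfl
  have main := flowJoined_pointLaw p (fun j => corner k (e j).1)
    (fun j => nearestLift (corner k (e j).1) (corner k (e j).2)) hℓ
  rw [hX, hY] at main
  refine main.mono ?_ ?_
  · gcongr
    refine Real.sqrt_le_iff.2 ⟨by positivity, ?_⟩
    have h1 : (Fintype.card J : ℝ) ≤ 2 * Fintype.card (Cell k) + 2 := by exact_mod_cast hcard
    have h2 : (Fintype.card (Cell k) : ℝ) = (2 ^ k) ^ 2 := by
      rw [← sqrt_card_cell, Real.sq_sqrt (by positivity)]
    have h3 : (1 : ℝ) ≤ (2 ^ k) ^ 2 := one_le_pow₀ (one_le_pow₀ (by norm_num))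
    nlinarith
  · gcongr
    simp_rw [norm_nearestLift_sub_sq, hp]
    calc ∑ j, w j * D (e j) = ∑ z, (q : Measure (Cell k × Cell k)).real {z} * D z := hcost
      _ = ∫ z, D z ∂(q : Measure (Cell k × Cell k)) := by
          rw [integral_fintype Integrable.of_finite]
          rfl
      _ = ∫ z, D (cellOf k z.1, cellOf k z.2) ∂(π : Measure (Torus2 × Torus2)) := by
          rw [hqm, integral_map hm.aemeasurable
            (measurable_of_finite D).aestronglyMeasurable]
      _ ≤ ∫ z, ((1 + δ) * perDistSq z.1 z.2 + (1 + 1 / δ) * (8 / 4 ^ k))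
            ∂(π : Measure (Torus2 × Torus2)) := by
          have hi : Integrable (fun z : Torus2 × Torus2 => perDistSq z.1 z.2)
              (π : Measure (Torus2 × Torus2)) :=
            continuous_perDistSq.integrable_of_hasCompactSupport (HasCompactSupport.of_compactSpace _)
          refine integral_mono_of_nonneg (Eventually.of_forall fun z => ?_)
            ((hi.const_mul _).add (integrable_const _))
            (Eventually.of_forall fun z => perDistSq_corner_le k z.1 z.2 hδ)
          exact Finset.sum_nonneg fun i _ => by positivity
      _ = _ := by
          have hi : Integrable (fun z : Torus2 × Torus2 => perDistSq z.1 z.2)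
              (π : Measure (Torus2 × Torus2)) :=
            continuous_perDistSq.integrable_of_hasCompactSupport (HasCompactSupport.of_compactSpace _)
          rw [integral_add (hi.const_mul _) (integrable_const _), integral_const_mul,
            integral_const, probReal_univ, one_smul]

end SparsePlan

end

/-! ### Existence of a minimizer and the energy bound -/

/-- The choice of the dyadic level at which the irrigation cost of the grid and the action of the
branching balance: the grid size is of order `T^{2/3}` for small `T`. -/
theorem exists_level {T : ℝ} (hT : 0 < T) :
    ∃ k : ℕ, T * 2 ^ k ≤ max T (T ^ (1 / 3 : ℝ)) ∧
      1 / (T * 4 ^ k) ≤ 4 * max T (T ^ (1 / 3 : ℝ)) := by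
  -- level `0` for `T ≥ 1`, otherwise the largest `k` with `2 ^ k ≤ T ^ (-2 / 3)`
  rcases le_or_gt 1 T with h1 | h1
  · refine ⟨0, by simp, ?_⟩
    have h2 : 1 / (T * 4 ^ 0) ≤ 1 := by
      rw [pow_zero, mul_one]
      exact (div_le_one hT).2 h1
    have h3 := le_max_left T (T ^ (1 / 3 : ℝ))
    linarith
  · set s := T ^ (1 / 3 : ℝ) with hs
    have hs0 : 0 < s := Real.rpow_pos_of_pos hT _
    have hs3 : s ^ 3 = T := by
      rw [hs, ← Real.rpow_natCast, ← Real.rpow_mul hT.le]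
      norm_num
    have hs1 : s ≤ 1 := Real.rpow_le_one hT.le h1.le (by norm_num)
    have hx : 1 ≤ 1 / s ^ 2 := (one_le_div (by positivity)).2 (pow_le_one₀ hs0.le hs1)
    obtain ⟨k, hk1, hk2⟩ := exists_nat_pow_near hx (one_lt_two (α := ℝ))
    rw [le_div_iff₀ (by positivity)] at hk1
    rw [div_lt_iff₀ (by positivity)] at hk2
    refine ⟨k, le_trans ?_ (le_max_right _ _), le_trans ?_
      (mul_le_mul_of_nonneg_left (le_max_right T s) (by norm_num))⟩
    · calc T * 2 ^ k = s * (2 ^ k * s ^ 2) := by rw [← hs3]; ring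
        _ ≤ s * 1 := by gcongr
        _ = s := mul_one s
    · rw [div_le_iff₀ (by positivity)]
      have h4 : (4 : ℝ) ^ k = (2 ^ k) ^ 2 := by rw [← pow_mul, mul_comm, pow_mul]; norm_num
      have h5 : 4 * s * (T * 4 ^ k) = (2 ^ (k + 1) * s ^ 2) ^ 2 := by
        rw [h4, ← hs3]
        ring
      rw [h5]
      exact one_le_pow₀ hk2.le

/-- A transport plan of cost `W` yields a flow whose energy is `(1 + η) W / (2T)` up to the cost of
branching: branch in from the initial measure, move along straight lines, and branch out to the final
measure. -/
theorem exists_flow_of_plan {T : ℝ} (hT : 0 < T) {α β : ProbabilityMeasure Torus2}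
    (π : ProbabilityMeasure (Torus2 × Torus2)) (hα : (π : Measure (Torus2 × Torus2)).fst = α)
    (hβ : (π : Measure (Torus2 × Torus2)).snd = β) {η : ℝ} (hη : 0 < η) (hη1 : η < 1) :
    ∃ (c : ℝ → ProbabilityMeasure Torus2) (P A : ℝ), 0 ≤ P ∧
      IsFlow (-T) T c (ENNReal.ofReal P) A ∧ c (-T) = α ∧ c T = β ∧
      P + A ≤ (1 + η) / (2 * T) * ∫ z, perDistSq z.1 z.2 ∂(π : Measure (Torus2 × Torus2)) +
        210 / η * max T (T ^ (1 / 3 : ℝ)) := by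
  set W := ∫ z, perDistSq z.1 z.2 ∂(π : Measure (Torus2 × Torus2)) with hW
  have hW0 : 0 ≤ W := integral_nonneg fun z => Finset.sum_nonneg fun i _ => by positivity
  set M := max T (T ^ (1 / 3 : ℝ)) with hM
  obtain ⟨k, hk1, hk2⟩ := exists_level hT
  rw [← hM] at hk1 hk2
  -- a fraction `η / 8` of the total time `2 T` is spent branching at each end, so that shortening the
  -- transport to the time `ℓ` costs less than a factor `(1 + η) / (1 + η / 4)`
  set τ := T * η / 6 with hτ
  have hτ0 : 0 < τ := by positivity
  set ℓ := 2 * T * (1 - η / 4) with hℓ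
  have hℓ0 : 0 < ℓ := by
    have : 0 < 1 - η / 4 := by linarith
    positivity
  have htime : 3 * τ / 2 + ℓ + 3 * τ / 2 = 2 * T := by
    rw [hτ, hℓ]
    ring
  set P := 6 * τ * 2 ^ k + ℓ * (2 * 2 ^ k) + 6 * τ * 2 ^ k with hP
  set A := 2 / (4 ^ k * τ) + ((1 + η / 4) * W + (1 + 1 / (η / 4)) * (8 / 4 ^ k)) / ℓ +
    2 / (4 ^ k * τ) with hA
  have hjoin : ∀ i, FlowJoined (2 * T) (gridApprox (k + i) α) (gridApprox (k + i) β) P A := by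
    intro i
    have h1 := (flowJoined_gridApprox_add α i k hτ0).1
    have h2 := flowJoined_of_plan k π hα hβ hℓ0 (show 0 < η / 4 by positivity)
    have h3 := (flowJoined_gridApprox_add β i k hτ0).2
    have := (h1.trans (by positivity) hℓ0.le (by positivity) (by positivity) h2).trans
      (by positivity) (by positivity) (by positivity) (by positivity) h3
    rwa [htime] at this
  choose c hc hcα hcβ using fun i => hjoin i (-T)
  have hend : -T + 2 * T = T := by ring
  simp only [hend] at hc hcβ
  have hlim : ∀ γ : ProbabilityMeasure Torus2,
      Tendsto (fun i => gridApprox (k + i) γ) atTop (𝓝 γ) := fun γ =>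
    (tendsto_gridApprox γ).comp (tendsto_atTop_mono (fun i => Nat.le_add_left i k) tendsto_id)
  obtain ⟨c₀, hc₀, h0α, h0β⟩ := exists_limit_flow (by linarith) hc tendsto_const_nhds
    tendsto_const_nhds (by simpa only [hcα] using hlim α) (by simpa only [hcβ] using hlim β)
  refine ⟨c₀, P, A, by positivity, hc₀, h0α, h0β, ?_⟩
  have hM0 : 0 < M := lt_max_of_lt_left hT
  have hPle : P ≤ 6 / η * M := by
    have e : P = (4 + η) * (T * 2 ^ k) := by
      rw [hP, hτ, hℓ]
      ring
    have h6 : 4 + η ≤ 6 / η := by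
      rw [le_div_iff₀ hη]
      nlinarith
    calc P = (4 + η) * (T * 2 ^ k) := e
      _ ≤ 6 / η * M := by gcongr
  have hinv : 1 / ℓ ≤ (1 + η) / (1 + η / 4) / (2 * T) := by
    rw [div_div, div_le_div_iff₀ hℓ0 (by positivity), hℓ]
    nlinarith [mul_pos hT hη, mul_pos (mul_pos hT hη) (sub_pos.2 hη1)]
  have hAW : (1 + η / 4) * W / ℓ ≤ (1 + η) / (2 * T) * W := by
    calc (1 + η / 4) * W / ℓ = (1 + η / 4) * W * (1 / ℓ) := by ring
      _ ≤ (1 + η / 4) * W * ((1 + η) / (1 + η / 4) / (2 * T)) := by gcongr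
      _ = (1 + η) / (2 * T) * W := by
          field_simp
  have hAe : (1 + 1 / (η / 4)) * (8 / 4 ^ k) / ℓ ≤ 27 / η * (1 / (T * 4 ^ k)) := by
    have hl : 3 / 2 * T ≤ ℓ := by
      rw [hℓ]
      nlinarith
    have h5 : 1 + 1 / (η / 4) ≤ 5 / η := by
      rw [le_div_iff₀ hη, add_mul, one_mul, one_div_div, div_mul_cancel₀ _ hη.ne']
      linarith
    calc (1 + 1 / (η / 4)) * (8 / 4 ^ k) / ℓ ≤ 5 / η * (8 / 4 ^ k) / (3 / 2 * T) := by gcongr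
      _ = 80 / 3 / η * (1 / (T * 4 ^ k)) := by
          field_simp
          norm_num
      _ ≤ 27 / η * (1 / (T * 4 ^ k)) := by
          gcongr
          norm_num
  have hAb : 2 / (4 ^ k * τ) = 12 / η * (1 / (T * 4 ^ k)) := by
    rw [hτ]
    field_simp
    norm_num
  have hfinal : 51 / η * (1 / (T * 4 ^ k)) ≤ 204 / η * M := by
    calc 51 / η * (1 / (T * 4 ^ k)) ≤ 51 / η * (4 * M) := by gcongr
      _ = 204 / η * M := by ring
  have hAsplit : A = 24 / η * (1 / (T * 4 ^ k)) + ((1 + η / 4) * W / ℓ +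
      (1 + 1 / (η / 4)) * (8 / 4 ^ k) / ℓ) := by
    rw [hA, hAb, add_div]
    ring
  have e1 : 51 / η * (1 / (T * 4 ^ k)) =
      24 / η * (1 / (T * 4 ^ k)) + 27 / η * (1 / (T * 4 ^ k)) := by ring
  have e2 : 210 / η * M = 6 / η * M + 204 / η * M := by ring
  rw [hAsplit, e2]
  linarith

/-- Among all flows between two measures there is one of least total energy. -/
theorem exists_minimal_flow {T : ℝ} (hT : 0 < T) (α β : ProbabilityMeasure Torus2) :
    ∃ (c : ℝ → ProbabilityMeasure Torus2) (P A : ℝ), 0 ≤ P ∧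
      IsFlow (-T) T c (ENNReal.ofReal P) A ∧ c (-T) = α ∧ c T = β ∧
      ∀ (c' : ℝ → ProbabilityMeasure Torus2) (P' A' : ℝ), 0 ≤ P' →
        IsFlow (-T) T c' (ENNReal.ofReal P') A' → c' (-T) = α → c' T = β → P + A ≤ P' + A' := by
  have hTT : -T ≤ T := by linarith
  set S : Set ℝ := {e | ∃ (c : ℝ → ProbabilityMeasure Torus2) (P A : ℝ), 0 ≤ P ∧
    IsFlow (-T) T c (ENNReal.ofReal P) A ∧ c (-T) = α ∧ c T = β ∧ P + A = e} with hS
  have hne : S.Nonempty := by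
    obtain ⟨c, P, A, hP, hc, h1, h2, -⟩ := exists_flow_of_plan hT (α := α) (β := β) (α.prod β)
      (by simp [ProbabilityMeasure.toMeasure_prod]) (by simp [ProbabilityMeasure.toMeasure_prod])
      (η := 1 / 2) (by norm_num) (by norm_num)
    exact ⟨_, c, P, A, hP, hc, h1, h2, rfl⟩
  have hbdd : BddBelow S := by
    refine ⟨0, ?_⟩
    rintro _ ⟨c, P, A, hP, hc, -, -, rfl⟩
    exact add_nonneg hP (hc.action_nonneg hTT)
  obtain ⟨u, -, hu, huS⟩ := exists_seq_tendsto_sInf hne hbdd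
  choose c P A hP hc hcα hcβ hsum using huS
  have hA : ∀ n, 0 ≤ A n := fun n => (hc n).action_nonneg hTT
  obtain ⟨B, hB⟩ := hu.bddAbove_range
  have hmem : ∀ n, (P n, A n) ∈ Icc (0 : ℝ) B ×ˢ Icc (0 : ℝ) B := by
    intro n
    have h1 : u n ≤ B := hB ⟨n, rfl⟩
    have h2 := hsum n
    have h3 := hP n
    have h4 := hA n
    exact ⟨⟨h3, by simp only; linarith⟩, ⟨h4, by simp only; linarith⟩⟩
  obtain ⟨⟨P₀, A₀⟩, hmem₀, φ, hφ, hlim⟩ :=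
    (isCompact_Icc.prod isCompact_Icc).tendsto_subseq hmem
  have hP₀ : Tendsto (fun n => P (φ n)) atTop (𝓝 P₀) := (continuous_fst.tendsto _).comp hlim
  have hA₀ : Tendsto (fun n => A (φ n)) atTop (𝓝 A₀) := (continuous_snd.tendsto _).comp hlim
  obtain ⟨c₀, hc₀, h0α, h0β⟩ := exists_limit_flow hTT (fun n => hc (φ n))
    (ENNReal.tendsto_ofReal hP₀) hA₀ (α := α) (β := β) (by simp only [hcα]; exact tendsto_const_nhds)
    (by simp only [hcβ]; exact tendsto_const_nhds)
  have hinf : P₀ + A₀ = sInf S := by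
    refine tendsto_nhds_unique (hP₀.add hA₀) ?_
    simp only [hsum]
    exact hu.comp hφ.tendsto_atTop
  refine ⟨c₀, P₀, A₀, hmem₀.1.1, hc₀, h0α, h0β, fun c' P' A' hP' hc' h1 h2 => ?_⟩
  rw [hinf]
  exact csInf_le hbdd ⟨c', P', A', hP', hc', h1, h2, rfl⟩

theorem proposition3p5 :
    ∃ C : ℝ, 0 < C ∧ ∀ (T : ℝ), 0 < T → ∀ (μminus μplus : ProbabilityMeasure Torus2),
      ∃ (κ : Kernel ℝ Torus2) (m : VectorMeasure (ℝ × Torus2) (EuclideanSpace ℝ (Fin 2))),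
        IsAdmissible T κ m ∧ HasTraces T κ μminus μplus ∧
        pairEnergy T κ m = irrigationEnergy T κ ∧
        (∀ (κ' : Kernel ℝ Torus2) (m' : VectorMeasure (ℝ × Torus2) (EuclideanSpace ℝ (Fin 2))),
          IsAdmissible T κ' m' → HasTraces T κ' μminus μplus →
            irrigationEnergy T κ ≤ irrigationEnergy T κ') ∧
        ∀ η : ℝ, 0 < η → η < 1 →
          irrigationEnergy T κ ≤
            ENNReal.ofReal ((1 + η) / (2 * T)) * wassersteinPerSq μminus μplus +
              ENNReal.ofReal (C / η * max T (T ^ (1 / 3 : ℝ))) := by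
  refine ⟨210, by norm_num, fun T hT μminus μplus => ?_⟩
  have hTT : -T ≤ T := by linarith
  obtain ⟨c, P, A, hP, hc, hcα, hcβ, hmin⟩ := exists_minimal_flow hT μminus μplus
  have hA := hc.action_nonneg hTT
  obtain ⟨κ, m, hadm, htr, henergy⟩ := hc.exists_admissible hT ENNReal.ofReal_ne_top
  rw [hcα, hcβ] at htr
  rw [← ENNReal.ofReal_add hP hA] at henergy
  have hle : ∀ (κ' : Kernel ℝ Torus2)
      (m' : VectorMeasure (ℝ × Torus2) (EuclideanSpace ℝ (Fin 2))),
      IsAdmissible T κ' m' → HasTraces T κ' μminus μplus →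
        ENNReal.ofReal (P + A) ≤ pairEnergy T κ' m' := by
    intro κ' m' hadm' htr'
    rcases eq_or_ne (pairEnergy T κ' m') ⊤ with htop | hfin
    · rw [htop]
      exact le_top
    rw [pairEnergy, ENNReal.add_ne_top] at hfin
    obtain ⟨c', hc', h1, h2⟩ := hadm'.exists_flow hT hfin.2 htr'
    rw [← ENNReal.ofReal_toReal hfin.1] at hc'
    have h3 := hmin c' _ _ ENNReal.toReal_nonneg hc' h1 h2
    refine (ENNReal.ofReal_le_ofReal h3).trans ?_
    rw [ENNReal.ofReal_add ENNReal.toReal_nonneg ENNReal.toReal_nonneg,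
      ENNReal.ofReal_toReal hfin.1, ENNReal.ofReal_toReal hfin.2, pairEnergy]
  have hirr : irrigationEnergy T κ ≤ pairEnergy T κ m := iInf₂_le m hadm
  refine ⟨κ, m, hadm, htr, ?_, ?_, ?_⟩
  · exact le_antisymm (le_iInf₂ fun m' hadm' => henergy.trans (hle κ m' hadm' htr)) hirr
  · intro κ' m' _ htr'
    exact (hirr.trans henergy).trans (le_iInf₂ fun m'' hadm'' => hle κ' m'' hadm'' htr')
  · intro η hη hη1
    have hplan : ∀ π : Measure (Torus2 × Torus2),
        π.fst = (μminus : Measure Torus2) ∧ π.snd = (μplus : Measure Torus2) →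
        irrigationEnergy T κ ≤ ENNReal.ofReal ((1 + η) / (2 * T)) *
          (∫⁻ p, ENNReal.ofReal (perDistSq p.1 p.2) ∂π) +
            ENNReal.ofReal (210 / η * max T (T ^ (1 / 3 : ℝ))) := by
      rintro π ⟨hα, hβ⟩
      have hprob : IsProbabilityMeasure π := by
        constructor
        rw [← Measure.fst_univ, hα, measure_univ]
      obtain ⟨c', P', A', hP', hc', h1, h2, hbound⟩ :=
        exists_flow_of_plan hT (α := μminus) (β := μplus) ⟨π, hprob⟩ hα hβ hη hη1
      replace hbound : P' + A' ≤ (1 + η) / (2 * T) * ∫ z, perDistSq z.1 z.2 ∂π +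
        210 / η * max T (T ^ (1 / 3 : ℝ)) := hbound
      have hnn : ∀ z : Torus2 × Torus2, 0 ≤ perDistSq z.1 z.2 := fun z =>
        Finset.sum_nonneg fun i _ => by positivity
      have hint : Integrable (fun z : Torus2 × Torus2 => perDistSq z.1 z.2) π :=
        continuous_perDistSq.integrable_of_hasCompactSupport (HasCompactSupport.of_compactSpace _)
      rw [← ofReal_integral_eq_lintegral_ofReal hint (Eventually.of_forall hnn),
        ← ENNReal.ofReal_mul (by positivity),
        ← ENNReal.ofReal_add (mul_nonneg (by positivity) (integral_nonneg hnn))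
          (mul_nonneg (by positivity) (hT.le.trans (le_max_left _ _)))]
      exact (hirr.trans henergy).trans (ENNReal.ofReal_le_ofReal
        ((hmin c' P' A' hP' hc' h1 h2).trans hbound))
    rw [wassersteinPerSq, ENNReal.mul_iInf_of_ne (by
      rw [ne_eq, ENNReal.ofReal_eq_zero, not_le]
      positivity) ENNReal.ofReal_ne_top, ENNReal.iInf_add]
    refine le_iInf fun π => ?_
    by_cases hπ : π.fst = (μminus : Measure Torus2) ∧ π.snd = (μplus : Measure Torus2)
    · rw [iInf_pos hπ]
      exact hplan π hπ
    · have h0 : ENNReal.ofReal ((1 + η) / (2 * T)) ≠ 0 := by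
        rw [ne_eq, ENNReal.ofReal_eq_zero, not_le]
        positivity
      rw [iInf_neg hπ, ENNReal.mul_top h0, top_add]
      exact le_top
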